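/- Let $\mathfrak X_0$ be an integral normal scheme which is flat and of finite type over $\operatorname{Spec}\mathbb Z$, with function field $K_0$. Let $K/K_0$ be a Galois extension which is radically closed in the sense that every polynomial $T^N-a$ with $N\ge 1$ and $a\in K$ splits into linear factors over $K$. Put $G=\mathrm{Gal}(K/K_0)$, let $\pi:\mathfrak X\to\mathfrak X_0$ be the normalization of $\mathfrak X_0$ in $K$ with its induced $G$-action, and let $\mathbb C$ be any algebraically closed field of characteristic zero. Let $\mathcal E$ be a condition on characters $\chi:\kappa(x)^\times\to\mathbb C^\times$, $x\in\mathfrak X$, such that: every $\chi$ with finite kernel satisfies $\mathcal E$; if $\chi$ satisfies $\mathcal E$, then the torsion subgroup of $\ker\chi$ is finite, and $\kappa(x)^\times$ is a torsion group whenever the image of $\chi$ consists of roots of unity; and $\mathcal E$ is preserved under $\chi\mapsto\chi\circ(\;)^\nu$ for all integers $\nu\ge1$ and under the action of $G$. Let $\dot{\mathfrak X}(\mathbb C)$ be the set of pairs $(x,\chi)$ with $x\in\mathfrak X$ and $\chi:\kappa(x)^\times\to\mathbb C^\times$ a homomorphism satisfying $\mathcal E$, with the right $G$-action $(x,\chi)^\sigma=(\sigma^{-1}(x),\chi\circ\sigma)$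 and the commuting maps $F_\nu(x,\chi)=(x,\chi\circ(\;)^\nu)$ for integers $\nu\ge1$. Put $\dot{\mathfrak X}_0(\mathbb C)=\dot{\mathfrak X}(\mathbb C)/G$, and let $\check{\mathfrak X}_0(\mathbb C)$ be the colimit of copies of $\dot{\mathfrak X}_0(\mathbb C)$ indexed by the positive integers ordered by divisibility, with transition maps the $F_\nu$. The $F_\nu$ become bijective on $\check{\mathfrak X}_0(\mathbb C)$, and $\mathbb Q^{>0}$ acts on it by $F_{\nu/\nu'}=F_\nu\circ F_{\nu'}^{-1}$. The map $(x,\chi)\mapsto\pi(x)$ induces a $\mathbb Q^{>0}$-invariant projection $\mathrm{pr}:\check{\mathfrak X}_0(\mathbb C)\to\mathfrak X_0$. For a closed point $x_0$ of $\mathfrak X_0$ put $C_{x_0}=\mathrm{pr}^{-1}(x_0)$ and $Nx_0=|\kappa(x_0)|$, the (finite) number of elements of its residue field. Then $$\{P_0\in\check{\mathfrak X}_0(\mathbb C)\mid(\mathbb Q^{>0})_{P_0}\neq1\}=\coprod_{x_0}C_{x_0},$$ where $x_0$ runs over the closed points of $\mathfrak X_0$ and $(\mathbb Q^{>0})_{P_0}$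 denotes the stabilizer of $P_0$. For every closed point $x_0$ and every $P_0\in C_{x_0}$, the stabilizer is $(\mathbb Q^{>0})_{P_0}=(Nx_0)^{\mathbb Z}=\{(Nx_0)^n\mid n\in\mathbb Z\}$. -/

import Mathlib

open CategoryTheory AlgebraicGeometry

universe u v

noncomputable section

namespace ArithScheme

/-! ### The normalization of an integral scheme in an extension of its function field -/

section Normalization

variable (X₀ : Scheme.{u}) [IsIntegral X₀] (K : Type u) [Field K] [Algebra X₀.functionField K]

/-- The morphism `Spec K ⟶ X₀` onto the generic point. -/
def specTo : Spec (CommRingCat.of K) ⟶ X₀ :=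
  Spec.map (CommRingCat.ofHom (algebraMap X₀.functionField K)) ≫
    X₀.fromSpecStalk (genericPoint X₀)

instance : QuasiCompact (specTo X₀ K) := inferInstance

instance : QuasiSeparated (specTo X₀ K) := inferInstance

/-- The normalization `𝔛` of `X₀` in `K`. -/
abbrev normalizationIn : Scheme.{u} := (specTo X₀ K).normalization

/-- The structure morphism `π : 𝔛 ⟶ X₀`. -/
abbrev normProj : normalizationIn X₀ K ⟶ X₀ := (specTo X₀ K).fromNormalization

/-- The Galois group of `K` over the function field of `X₀`. -/
abbrev Gal : Type u := K ≃ₐ[X₀.functionField] K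

variable {K}

/-- `Spec σ` for an element `σ` of the Galois group. -/
def specGal (σ : Gal X₀ K) : Spec (CommRingCat.of K) ⟶ Spec (CommRingCat.of K) :=
  Spec.map (CommRingCat.ofHom (σ : K →+* K))

lemma specGal_specTo (σ : Gal X₀ K) : specGal X₀ σ ≫ specTo X₀ K = specTo X₀ K := by
  rw [specTo, specGal, ← Category.assoc, ← Spec.map_comp, ← CommRingCat.ofHom_comp]
  congr 3
  ext a
  simp

/-- The automorphism of `𝔛` over `X₀` that `σ` induces by functoriality, that is, the unique one
compatible with `Spec σ`. On points it is `x ↦ σ⁻¹(x)` (a prime `𝔭` of the integral closure goes to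
the prime `σ⁻¹(𝔭)`), and on functions it is `σ`. -/
def galHom (σ : Gal X₀ K) : normalizationIn X₀ K ⟶ normalizationIn X₀ K :=
  (specTo X₀ K).normalizationDesc (specGal X₀ σ ≫ (specTo X₀ K).toNormalization)
    (normProj X₀ K) (by simp [specGal_specTo])

lemma toNormalization_galHom (σ : Gal X₀ K) :
    (specTo X₀ K).toNormalization ≫ galHom X₀ σ =
      specGal X₀ σ ≫ (specTo X₀ K).toNormalization := by
  simp [galHom]

lemma galHom_normProj (σ : Gal X₀ K) : galHom X₀ σ ≫ normProj X₀ K = normProj X₀ K := by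
  simp [galHom]

lemma galHom_one : galHom X₀ (1 : Gal X₀ K) = 𝟙 _ := by
  refine Scheme.Hom.normalization.hom_ext (specTo X₀ K) _ _ (normProj X₀ K) ?_
    (galHom_normProj X₀ 1) (by simp)
  rw [toNormalization_galHom, Category.comp_id]
  have : specGal X₀ (1 : Gal X₀ K) = 𝟙 _ := by
    rw [specGal, ← Spec.map_id]
    rfl
  rw [this, Category.id_comp]

lemma galHom_mul (σ τ : Gal X₀ K) : galHom X₀ (σ * τ) = galHom X₀ σ ≫ galHom X₀ τ := by
  refine Scheme.Hom.normalization.hom_ext (specTo X₀ K) _ _ (normProj X₀ K) ?_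
    (galHom_normProj X₀ _) (by rw [Category.assoc, galHom_normProj, galHom_normProj])
  rw [toNormalization_galHom, ← Category.assoc, toNormalization_galHom, Category.assoc,
    toNormalization_galHom, ← Category.assoc]
  congr 1
  rw [specGal, specGal, specGal, ← Spec.map_comp]
  rfl

lemma normProj_galHom_apply (σ : Gal X₀ K) (x : normalizationIn X₀ K) :
    normProj X₀ K (galHom X₀ σ x) = normProj X₀ K x := by
  rw [← Scheme.Hom.comp_apply, galHom_normProj]

end Normalization

/-! ### Multiplicative characters on residue fields -/

section Characters

/-- Multiplicative characters of the residue field at a point `x` of a scheme. -/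
abbrev ResChar {X : Scheme.{u}} (C : Type v) [Field C] (x : X) : Type (max u v) :=
  (X.residueField x)ˣ →* Cˣ

/-- Pullback of a character along the homomorphism `κ(f x) → κ(x)` induced by `f`. -/
def ResChar.comap {X Y : Scheme.{u}} {C : Type v} [Field C] (f : X ⟶ Y) {x : X}
    (χ : ResChar C x) : ResChar C (f x) :=
  χ.comp (Units.map ((f.residueFieldMap x).hom : Y.residueField (f x) →* X.residueField x))

/-- The character `χ ∘ ( )^ν`. -/
def ResChar.frob {X : Scheme.{u}} {C : Type v} [Field C] {x : X} (χ : ResChar C x) (ν : ℕ+) :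
    ResChar C x :=
  χ.comp (powMonoidHom (ν : ℕ))

lemma ResChar.comap_frob {X Y : Scheme.{u}} {C : Type v} [Field C] (f : X ⟶ Y) {x : X}
    (χ : ResChar C x) (ν : ℕ+) : (χ.frob ν).comap f = (χ.comap f).frob ν :=
  MonoidHom.ext fun y ↦ congrArg χ (map_pow (Units.map
    ((f.residueFieldMap x).hom : Y.residueField (f x) →* X.residueField x)) y (ν : ℕ)).symm

/-- A point of `X` with a character of its residue field. -/
abbrev CharPoint (X : Scheme.{u}) (C : Type v) [Field C] : Type (max u v) :=
  Σ x : X, ResChar C x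

/-- `(x, χ) ↦ (f x, χ ∘ f^*)`. -/
def CharPoint.map {X Y : Scheme.{u}} {C : Type v} [Field C] (f : X ⟶ Y) (P : CharPoint X C) :
    CharPoint Y C :=
  ⟨f P.1, P.2.comap f⟩

lemma CharPoint.map_id {X : Scheme.{u}} {C : Type v} [Field C] (P : CharPoint X C) :
    P.map (𝟙 X) = P := by
  obtain ⟨x, χ⟩ := P
  have h : Scheme.Hom.residueFieldMap (𝟙 X) x = 𝟙 (X.residueField x) :=
    Scheme.residueFieldMap_id x
  refine Sigma.ext rfl (heq_of_eq (MonoidHom.ext fun y ↦ congrArg χ (Units.ext ?_)))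
  change (X.residueField x)ˣ at y
  exact congrArg (fun g : X.residueField x ⟶ X.residueField x ↦ g.hom (y : X.residueField x)) h

lemma CharPoint.map_comp {X Y Z : Scheme.{u}} {C : Type v} [Field C] (f : X ⟶ Y) (g : Y ⟶ Z)
    (P : CharPoint X C) : P.map (f ≫ g) = (P.map f).map g := by
  obtain ⟨x, χ⟩ := P
  have h : (f ≫ g).residueFieldMap x = g.residueFieldMap (f x) ≫ f.residueFieldMap x :=
    Scheme.residueFieldMap_comp f g x
  refine Sigma.ext rfl (heq_of_eq (MonoidHom.ext fun y ↦ congrArg χ (Units.ext ?_)))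
  change (Z.residueField (g (f x)))ˣ at y
  exact congrArg
    (fun t : Z.residueField (g (f x)) ⟶ X.residueField x ↦ t.hom (y : Z.residueField (g (f x)))) h

/-- The strongest condition on a character: its kernel is finite. -/
def FiniteKer {k : Type u} {C : Type v} [Field k] [Field C] (χ : kˣ →* Cˣ) : Prop :=
  (χ.ker : Set kˣ).Finite

/-- The weakest condition on a character: the torsion of its kernel is finite, and if all of its
values are roots of unity, then `kˣ` is a torsion group. -/
def MaxCondition {k : Type u} {C : Type v} [Field k] [Field C] (χ : kˣ →* Cˣ) : Prop :=
  {y : kˣ | y ∈ χ.ker ∧ IsOfFinOrder y}.Finite ∧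
    ((∀ y : kˣ, IsOfFinOrder (χ y)) → ∀ y : kˣ, IsOfFinOrder y)

variable (X₀ : Scheme.{u}) [IsIntegral X₀] (K : Type u) [Field K] [Algebra X₀.functionField K]
  (C : Type v) [Field C]

/-- An admissible condition `ℰ` on the characters of the residue fields of `𝔛`: it lies between
the conditions `FiniteKer` and `MaxCondition` and is stable under `χ ↦ χ ∘ ( )^ν` (so that the
Frobenius maps are defined) and under the Galois group (so that its action is defined). -/
structure CharCondition where
  /-- the characters that satisfy the condition -/
  holds : ∀ x : normalizationIn X₀ K, ResChar C x → Prop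
  of_finiteKer : ∀ (x : normalizationIn X₀ K) (χ : ResChar C x), FiniteKer χ → holds x χ
  maxCondition : ∀ (x : normalizationIn X₀ K) (χ : ResChar C x), holds x χ → MaxCondition χ
  pow : ∀ (x : normalizationIn X₀ K) (χ : ResChar C x) (ν : ℕ+), holds x χ → holds x (χ.frob ν)
  gal : ∀ (σ : Gal X₀ K) (x : normalizationIn X₀ K) (χ : ResChar C x),
    holds x χ → holds (galHom X₀ σ x) (χ.comap (galHom X₀ σ))

variable {X₀ K C}

/-- The set of pairs `(x, χ)` with `x ∈ 𝔛` and `χ : κ(x)ˣ → Cˣ` a character satisfying `ℰ`. -/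
@[ext]
structure DotX (E : CharCondition X₀ K C) : Type (max u v) where
  /-- the point of `𝔛` with the character of its residue field -/
  point : CharPoint (normalizationIn X₀ K) C
  holds : E.holds point.1 point.2

/-- The right action of the Galois group, `(x, χ)^σ = (σ⁻¹(x), χ ∘ σ)`, written as a left action
of the opposite group. -/
instance (E : CharCondition X₀ K C) : MulAction (Gal X₀ K)ᵐᵒᵖ (DotX E) where
  smul σ P := ⟨P.point.map (galHom X₀ σ.unop), E.gal σ.unop P.point.1 P.point.2 P.holds⟩
  one_smul P := DotX.ext <| by
    change P.point.map (galHom X₀ 1) = P.point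
    rw [galHom_one, CharPoint.map_id]
  mul_smul σ τ P := DotX.ext <| by
    change P.point.map (galHom X₀ (τ.unop * σ.unop)) =
      (P.point.map (galHom X₀ τ.unop)).map (galHom X₀ σ.unop)
    rw [galHom_mul, CharPoint.map_comp]

/-- The Frobenius maps `F_ν (x, χ) = (x, χ ∘ ( )^ν)`. -/
instance (E : CharCondition X₀ K C) : MulAction ℕ+ (DotX E) where
  smul ν P := ⟨⟨P.point.1, P.point.2.frob ν⟩, E.pow P.point.1 P.point.2 ν P.holds⟩
  one_smul P := DotX.ext <| Sigma.ext rfl <| heq_of_eq <| MonoidHom.ext fun y ↦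
    congrArg P.point.2 (pow_one y)
  mul_smul μ ν P := DotX.ext <| Sigma.ext rfl <| heq_of_eq <| MonoidHom.ext fun y ↦
    congrArg P.point.2 (pow_mul y (μ : ℕ) (ν : ℕ))

instance (E : CharCondition X₀ K C) : SMulCommClass ℕ+ (Gal X₀ K)ᵐᵒᵖ (DotX E) where
  smul_comm ν σ P := DotX.ext <| Sigma.ext rfl <| heq_of_eq
    (P.point.2.comap_frob (galHom X₀ σ.unop) ν).symm

/-- The orbit set of the Galois group on `DotX E`. -/
def DotX₀ (E : CharCondition X₀ K C) : Type (max u v) :=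
  MulAction.orbitRel.Quotient (Gal X₀ K)ᵐᵒᵖ (DotX E)

/-- The Frobenius maps on the orbit set. -/
instance (E : CharCondition X₀ K C) : MulAction ℕ+ (DotX₀ E) where
  smul ν := Quotient.map (ν • ·) <| by
    rintro _ P ⟨σ, rfl⟩
    exact ⟨σ, (smul_comm ν σ P).symm⟩
  one_smul := by
    rintro ⟨P⟩
    exact congrArg (Quotient.mk _) (one_smul ℕ+ P)
  mul_smul μ ν := by
    rintro ⟨P⟩
    exact congrArg (Quotient.mk _) (mul_smul μ ν P)

/-- The projection from the orbit set to `X₀`, induced by `(x, χ) ↦ π(x)`. -/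
def prDot (E : CharCondition X₀ K C) : DotX₀ E → X₀ :=
  Quotient.lift (fun P : DotX E ↦ normProj X₀ K P.point.1) <| by
    rintro _ P ⟨σ, rfl⟩
    exact normProj_galHom_apply X₀ σ.unop P.point.1

lemma prDot_smul (E : CharCondition X₀ K C) (ν : ℕ+) (P : DotX₀ E) :
    prDot E (ν • P) = prDot E P := by
  obtain ⟨P⟩ := P
  rfl

end Characters

/-! ### Inverting the Frobenius maps -/

section Colimit

/-- The relation that defines the colimit, over the positive integers `ν` ordered by divisibility,
of copies of an `ℕ+`-set `Y` along the maps `F_μ`: the pair `(P, ν)` stands for the element `P` of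
the copy with index `ν`, that is, for `F_ν⁻¹(P)`. -/
def frobSetoid (Y : Type u) [MulAction ℕ+ Y] : Setoid (Y × ℕ+) where
  r a b := ∃ μ : ℕ+, (μ * b.2) • a.1 = (μ * a.2) • b.1
  iseqv :=
    { refl := fun _ ↦ ⟨1, rfl⟩
      symm := fun ⟨μ, h⟩ ↦ ⟨μ, h.symm⟩
      trans := by
        rintro ⟨P, a⟩ ⟨Q, b⟩ ⟨R, c⟩ ⟨μ, h⟩ ⟨ν, k⟩
        refine ⟨μ * ν * b, ?_⟩
        have h' := congrArg ((ν * c) • ·) h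
        have k' := congrArg ((μ * a) • ·) k
        simp only [← mul_smul] at h' k'
        rw [show μ * ν * b * c = ν * c * (μ * b) by ac_rfl, h',
          show ν * c * (μ * a) = μ * a * (ν * c) by ac_rfl, k',
          show μ * a * (ν * b) = μ * ν * b * a by ac_rfl] }

/-- The colimit of `Y` over the positive integers ordered by divisibility, with transition maps
the Frobenius maps. -/
def FrobColim (Y : Type u) [MulAction ℕ+ Y] : Type u := Quotient (frobSetoid Y)

/-- The numerator of a positive rational number. -/
def posNum (q : {q : ℚ // 0 < q}) : ℕ+ :=
  ⟨q.1.num.toNat, by have := Rat.num_pos.2 q.2; omega⟩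

/-- The denominator of a positive rational number. -/
def posDen (q : {q : ℚ // 0 < q}) : ℕ+ := ⟨q.1.den, q.1.den_pos⟩

lemma posNum_div_posDen (q : {q : ℚ // 0 < q}) :
    ((posNum q : ℕ) : ℚ) / ((posDen q : ℕ) : ℚ) = q.1 := by
  have h : ((posNum q : ℕ) : ℤ) = q.1.num := Int.toNat_of_nonneg (Rat.num_pos.2 q.2).le
  have h' : ((posNum q : ℕ) : ℚ) = (q.1.num : ℚ) := by exact_mod_cast h
  rw [h']
  exact Rat.num_div_den q.1

lemma posNum_mul (q r : {q : ℚ // 0 < q}) :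
    posNum (q * r) * (posDen q * posDen r) = posNum q * posNum r * posDen (q * r) := by
  have h₁ := posNum_div_posDen (q * r)
  have h₂ := posNum_div_posDen q
  have h₃ := posNum_div_posDen r
  have e : (q * r).1 = q.1 * r.1 := rfl
  have p₁ : ((posDen (q * r) : ℕ) : ℚ) ≠ 0 := by positivity
  have p₂ : ((posDen q : ℕ) : ℚ) ≠ 0 := by positivity
  have p₃ : ((posDen r : ℕ) : ℚ) ≠ 0 := by positivity
  rw [e, ← h₂, ← h₃] at h₁
  field_simp at h₁
  apply PNat.coe_injective
  have : ((posNum (q * r) : ℕ) : ℚ) * (((posDen q : ℕ) : ℚ) * ((posDen r : ℕ) : ℚ)) =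
      ((posNum q : ℕ) : ℚ) * ((posNum r : ℕ) : ℚ) * ((posDen (q * r) : ℕ) : ℚ) := by
    linarith
  push_cast
  exact_mod_cast this

/-- The action of the group of positive rational numbers on the colimit: for `q = n / d` one has
`q • F_ν⁻¹(P) = F_n F_d⁻¹ F_ν⁻¹(P) = F_{dν}⁻¹(F_n(P))`. -/
instance (Y : Type u) [MulAction ℕ+ Y] : MulAction {q : ℚ // 0 < q} (FrobColim Y) where
  smul q := Quotient.map (fun a : Y × ℕ+ ↦ (posNum q • a.1, posDen q * a.2)) <| by
    rintro ⟨P, a⟩ ⟨Q, b⟩ ⟨μ, h⟩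
    refine ⟨μ, ?_⟩
    have h' := congrArg ((posNum q * posDen q) • ·) h
    simp only [← mul_smul] at h' ⊢
    rw [show μ * (posDen q * b) * posNum q = posNum q * posDen q * (μ * b) by ac_rfl, h',
      show posNum q * posDen q * (μ * a) = μ * (posDen q * a) * posNum q by ac_rfl]
  one_smul := by
    rintro ⟨P, a⟩
    refine Quotient.sound ⟨1, ?_⟩
    rw [show posNum 1 = 1 from rfl, show posDen 1 = 1 from rfl]
    simp
  mul_smul q r := by
    rintro ⟨P, a⟩
    refine Quotient.sound ⟨1, ?_⟩
    have h := posNum_mul q r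
    simp only [← mul_smul, one_mul]
    rw [show posDen q * (posDen r * a) * posNum (q * r) =
        posNum (q * r) * (posDen q * posDen r) * a by ac_rfl, h]
    congr 1
    ac_rfl

end Colimit

/-! ### The `ℚ^{>0}`-set attached to `X₀` -/

section System

variable {X₀ : Scheme.{u}} [IsIntegral X₀] {K : Type u} [Field K] [Algebra X₀.functionField K]
  {C : Type v} [Field C]

/-- The `ℚ^{>0}`-set attached to `X₀`: the colimit of the Galois orbit set along the Frobenius
maps. -/
abbrev CheckX₀ (E : CharCondition X₀ K C) : Type (max u v) := FrobColim (DotX₀ E)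

/-- The projection of `CheckX₀ E` to `X₀`, which sends `F_ν⁻¹(P)` to the image of `P`. -/
def prCheck (E : CharCondition X₀ K C) : CheckX₀ E → X₀ :=
  Quotient.lift (fun a : DotX₀ E × ℕ+ ↦ prDot E a.1) <| by
    rintro ⟨P, a⟩ ⟨Q, b⟩ ⟨μ, h⟩
    have := congrArg (prDot E) h
    rwa [prDot_smul, prDot_smul] at this

/-- The fibre of `CheckX₀ E` over a point of `X₀`. -/
def fiberC (E : CharCondition X₀ K C) (x₀ : X₀) : Set (CheckX₀ E) := prCheck E ⁻¹' {x₀}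

end System

end ArithScheme

end

/-! Write `q = a/b` in lowest terms. It fixes `F_ν⁻¹[(x, χ)]` iff, for some `μ ≥ 1` and some `σ` in
the Galois group fixing `x`, `χ(z)^(μa) = χ(σz)^(μb)` on `κ(x)ˣ` (`mem_stabilizer_mk_mk_iff`).
Everything follows from this relation.

If `q ≠ 1`, the point lies over a closed point: `κ(x)` is algebraic over `κ(π x)`, so `σ` has finite
orbits on it. Iterating the relation around an orbit shows that every value of `χ` is a root of
unity. The condition `ℰ` then makes `κ(x)ˣ` torsion, and a point with torsion unit group is closed
(`isClosed_of_mem_stabilizer`).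

Over a closed point `x₀` the field `κ(x₀)` is finite, so `κ(x)ˣ` is torsion and `ker χ` is finite.
Radical closedness of `K` passes to `κ(x)`. Extracting roots removes `χ` and leaves `y^a = σ(y)^b`.
Roots of unity of order prime to `p` force one of `a`, `b` to be a power of `p` and the other to be
`1`. On `κ(x₀)`, where `σ` is trivial, that power of `p` acts as the identity, so it is a power of
`Nx₀` (`pow_eq_zpow_card_of_character`).

Conversely, by normality of `X₀` the Frobenius of `κ(x)` over `κ(x₀)` lifts to some `σ` fixing `x`
(`exists_galHom_residueFieldEnd_eq_pow`). Then `χ(z)^N = χ(σz)` with `N = Nx₀`, so `N` lies in the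
stabilizer. -/

noncomputable section

/-! ### Frobenius, roots of unity and characters of fields over a finite field -/

/-- An endomorphism of an algebraic extension has finite orbits. -/
theorem exists_iterate_eq_of_isIntegral {F k : Type*} [Field F] [Field k] (i : F →+* k)
    (φ : k →+* k) (hφ : φ.comp i = i) (y : k) (hy : i.IsIntegralElem y) :
    ∃ n : ℕ, 0 < n ∧ φ^[n] y = y := by
  obtain ⟨p, hp, hpy⟩ := hy
  -- `φ` fixes the coefficients of a polynomial killing `y`, so the orbit stays in its finite root
  -- set.
  have key : ∀ n : ℕ, φ^[n] y ∈ (p.map i).rootSet k := by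
    intro n
    rw [Polynomial.mem_rootSet]
    refine ⟨(hp.map i).ne_zero, ?_⟩
    rw [Polynomial.aeval_def, Polynomial.eval₂_map, Algebra.algebraMap_self, RingHom.id_comp]
    induction n with
    | zero => exact hpy
    | succ n ih =>
      rw [Function.iterate_succ_apply', ← hφ, ← Polynomial.hom_eval₂, ih, map_zero]
  obtain ⟨a, b, hab, h⟩ : ∃ a b : ℕ, a < b ∧ φ^[a] y = φ^[b] y := by
    obtain ⟨a, b, hne, h⟩ := Finite.exists_ne_map_eq_of_infinite
      (fun n : ℕ ↦ (⟨φ^[n] y, key n⟩ : (p.map i).rootSet k))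
    have h' : φ^[a] y = φ^[b] y := congrArg Subtype.val h
    rcases lt_or_gt_of_ne hne with hlt | hlt
    · exact ⟨a, b, hlt, h'⟩
    · exact ⟨b, a, hlt, h'.symm⟩
  refine ⟨b - a, by omega, ?_⟩
  apply φ.injective.iterate a
  rw [← Function.iterate_add_apply, h]
  congr 2
  omega

/-- The units of an algebraic extension of a finite field have finite order. -/
theorem isOfFinOrder_of_isIntegral {F k : Type*} [Field F] [Finite F] [Field k] (i : F →+* k)
    (hi : i.IsIntegral) (y : kˣ) : IsOfFinOrder y := by
  have : Fintype F := Fintype.ofFinite F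
  let := i.toAlgebra
  -- For the Frobenius over `F`, a finite orbit is a relation `y ^ (|F| ^ n) = y`.
  obtain ⟨n, hn, h⟩ := exists_iterate_eq_of_isIntegral i
    (FiniteField.frobeniusAlgHom F k : k →+* k) (AlgHom.comp_algebraMap _) y (hi y)
  have h' : (y : k) ^ Fintype.card F ^ n = y := by
    rw [← h, AlgHom.coe_toRingHom, FiniteField.coe_frobeniusAlgHom, pow_iterate]
    rw [AlgHom.coe_toRingHom, FiniteField.coe_frobeniusAlgHom, pow_iterate] at h
    simp only [h]
  have hc : 1 < Fintype.card F ^ n := Nat.one_lt_pow hn.ne' Fintype.one_lt_card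
  rw [isOfFinOrder_iff_pow_eq_one]
  refine ⟨Fintype.card F ^ n - 1, by omega, ?_⟩
  rw [pow_sub y hc.le, pow_one, mul_inv_eq_one]
  exact Units.ext h'

/-- If `y ↦ y ^ p ^ n` is the identity on a finite field of characteristic `p`, then `p ^ n` is a
power of the cardinality of the field. -/
theorem exists_card_pow_eq_of_pow_eq {F : Type*} [Field F] [Finite F] {p : ℕ} [Fact p.Prime]
    [CharP F p] {n : ℕ} (h : ∀ y : F, y ^ p ^ n = y) : ∃ m : ℕ, p ^ n = Nat.card F ^ m := by
  let := ZMod.algebra F p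
  -- The order of the Frobenius of `F` over `𝔽_p` is the degree.
  have hd : Module.finrank (ZMod p) F ∣ n := by
    rw [← FiniteField.orderOf_frobeniusAlgHom (ZMod p) F, orderOf_dvd_iff_pow_eq_one]
    ext y
    rw [AlgHom.coe_pow, FiniteField.coe_frobeniusAlgHom, pow_iterate, ZMod.card]
    exact h y
  obtain ⟨m, rfl⟩ := hd
  refine ⟨m, ?_⟩
  rw [Module.natCard_eq_pow_finrank (K := ZMod p), Nat.card_zmod, pow_mul]

/-- In a field that contains all roots of unity, an endomorphism whose `b`-th power on units is
the `a`-th power map has `a` and `b` powers of the characteristic. -/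
theorem eq_one_and_exists_pow_of_pow_eq {k : Type*} [Field k] {p : ℕ} [Fact p.Prime]
    [CharP k p] (hord : ∀ l : ℕ, l.Prime → l ≠ p → ∃ y : kˣ, orderOf y = l)
    (φ : k →+* k) {a b : ℕ} (ha : a ≠ 0) (hb : b ≠ 0) (hab : a.Coprime b)
    (h : ∀ y : k, y ^ a = φ y ^ b) :
    (∃ n, a = p ^ n ∧ b = 1) ∨ (∃ n, a = 1 ∧ b = p ^ n) := by
  have hφ (y : kˣ) : orderOf (φ (y : k)) = orderOf y := by
    rw [← orderOf_units (y := y)]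
    exact orderOf_injective (φ : k →* k) φ.injective (y : k)
  have ha' : ∃ n, a = p ^ n := by
    refine ⟨_, Nat.eq_prime_pow_of_unique_prime_dvd ha fun {l} hl hla ↦ ?_⟩
    by_contra hlp
    -- For `y` of order `l`, the relation gives `φ y ^ b = 1`; since `φ` preserves orders, `l`
    -- divides both `a` and `b`.
    obtain ⟨y, hy⟩ := hord l hl hlp
    have h1 : φ (y : k) ^ b = 1 := by
      rw [← h, orderOf_dvd_iff_pow_eq_one.mp]
      rwa [orderOf_units, hy]
    have h2 : l ∣ b := by
      rw [← hy, ← hφ]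
      exact orderOf_dvd_of_pow_eq_one h1
    exact hl.one_lt.ne' (Nat.dvd_one.mp (hab ▸ Nat.dvd_gcd hla h2))
  have hb' : ∃ n, b = p ^ n := by
    refine ⟨_, Nat.eq_prime_pow_of_unique_prime_dvd hb fun {l} hl hlb ↦ ?_⟩
    by_contra hlp
    obtain ⟨y, hy⟩ := hord l hl hlp
    have h1 : (y : k) ^ a = 1 := by
      rw [h, orderOf_dvd_iff_pow_eq_one.mp]
      rwa [hφ, hy]
    have h2 : l ∣ a := by
      rw [← hy, ← orderOf_units]
      exact orderOf_dvd_of_pow_eq_one h1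
    exact hl.one_lt.ne' (Nat.dvd_one.mp (hab ▸ Nat.dvd_gcd h2 hlb))
  obtain ⟨m, rfl⟩ := ha'
  obtain ⟨n, rfl⟩ := hb'
  have hp : p.Prime := Fact.out
  rcases Nat.eq_zero_or_pos m with rfl | hm
  · exact .inr ⟨n, pow_zero p, rfl⟩
  rcases Nat.eq_zero_or_pos n with rfl | hn
  · exact .inl ⟨m, rfl, pow_zero p⟩
  · exact (hp.one_lt.ne' (Nat.dvd_one.mp (hab ▸
      Nat.dvd_gcd (dvd_pow_self p hm.ne') (dvd_pow_self p hn.ne')))).elim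

/-- A character with finite kernel of a divisible group of units which satisfies
`χ ^ (m a) = (χ ∘ φ) ^ (m b)` forces `y ^ a = φ y ^ b`. -/
theorem pow_eq_pow_of_character {k : Type*} [Field k] {M : Type*} [CommGroup M]
    (hdiv : ∀ (y : k) (n : ℕ), 0 < n → ∃ z : k, z ^ n = y) (χ : kˣ →* M)
    (hχ : (χ.ker : Set kˣ).Finite) (φ : k →+* k) {m a b : ℕ} (hm : 0 < m)
    (ha : a ≠ 0) (hb : b ≠ 0)
    (h : ∀ y : kˣ, χ y ^ (m * a) = χ (Units.map (φ : k →* k) y) ^ (m * b)) (y : k) :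
    y ^ a = φ y ^ b := by
  rcases eq_or_ne y 0 with rfl | hy
  · simp [ha, hb]
  have : Finite χ.ker := hχ
  have hc : 0 < Nat.card χ.ker := Nat.card_pos
  -- The factor `m` absorbs the `m` of the hypothesis. The factor `|ker χ|` kills the quotient of
  -- the two sides, which is only known to lie in `ker χ`.
  obtain ⟨z, hz⟩ := hdiv y (m * Nat.card χ.ker) (by positivity)
  have hz0 : z ≠ 0 := by
    rintro rfl
    rw [zero_pow (by positivity)] at hz
    exact hy hz.symm
  let w := Units.mk0 z hz0
  have hmem : w ^ (m * a) / Units.map (φ : k →* k) w ^ (m * b) ∈ χ.ker := by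
    rw [MonoidHom.mem_ker, map_div, map_pow, map_pow, h, div_self']
  have h1 := congrArg Subtype.val (pow_card_eq_one' (G := χ.ker) (x := ⟨_, hmem⟩))
  simp only [SubmonoidClass.coe_pow, OneMemClass.coe_one, div_pow, div_eq_one] at h1
  have h2 := congrArg Units.val h1
  simp only [Units.val_pow_eq_pow_val, Units.coe_map, MonoidHom.coe_coe, w, Units.val_mk0] at h2
  rw [← hz, map_pow, ← pow_mul, ← pow_mul]
  convert h2 using 1 <;> ring

/-- The sign of the exponent records which of `a` and `b` is the power of `p`. -/
theorem pow_eq_zpow_card_of_character {F k : Type*} [Field F] [Finite F] [Field k]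
    {M : Type*} [CommGroup M] (i : F →+* k)
    (hdiv : ∀ (y : k) (n : ℕ), 0 < n → ∃ z : k, z ^ n = y)
    (hsplit : ∀ n : ℕ, 0 < n → (Polynomial.X ^ n - 1 : Polynomial k).Splits) (χ : kˣ →* M)
    (hχ : (χ.ker : Set kˣ).Finite) (φ : k →+* k) (hφ : φ.comp i = i) {m a b : ℕ} (hm : 0 < m)
    (ha : a ≠ 0) (hb : b ≠ 0) (hab : a.Coprime b)
    (h : ∀ y : kˣ, χ y ^ (m * a) = χ (Units.map (φ : k →* k) y) ^ (m * b)) :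
    ∃ n : ℤ, (a : ℚ) / b = (Nat.card F : ℚ) ^ n := by
  obtain ⟨p, hp⟩ := CharP.exists F
  have : Fact p.Prime := ⟨CharP.char_is_prime F p⟩
  have : CharP k p := charP_of_injective_ringHom i.injective p
  have hpow := pow_eq_pow_of_character hdiv χ hχ φ hm ha hb h
  have hF (y : F) : y ^ a = y ^ b := by
    apply i.injective
    rw [map_pow, map_pow, hpow, ← RingHom.comp_apply, hφ]
  -- For `l ≠ p` the polynomial `X ^ l - 1` is separable and splits, so it has `l > 1` roots; any
  -- root other than `1` has order `l`.
  have hord : ∀ l : ℕ, l.Prime → l ≠ p → ∃ y : kˣ, orderOf y = l := by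
    intro l hl hlp
    have hl0 : (l : k) ≠ 0 := by
      rw [Ne, CharP.cast_eq_zero_iff k p, Nat.prime_dvd_prime_iff_eq Fact.out hl]
      exact fun h ↦ hlp h.symm
    have hsep : (Polynomial.X ^ l - 1 : Polynomial k).Separable :=
      Polynomial.X_pow_sub_one_separable_iff.mpr hl0
    have hcard := Polynomial.card_rootSet_eq_natDegree hsep
      (by simpa using hsplit l hl.pos)
    have hdeg : (Polynomial.X ^ l - 1 : Polynomial k).natDegree = l := by
      simpa using Polynomial.natDegree_X_pow_sub_C (n := l) (r := (1 : k))
    rw [hdeg] at hcard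
    obtain ⟨⟨y, hy⟩, hy1⟩ := Fintype.exists_ne_of_one_lt_card (hl.one_lt.trans_eq hcard.symm)
      (⟨1, by
        rw [Polynomial.mem_rootSet]
        exact ⟨hsep.ne_zero, by simp⟩⟩ :
        (Polynomial.X ^ l - 1 : Polynomial k).rootSet k)
    have hy' : y ^ l = 1 := by
      have := (Polynomial.mem_rootSet.mp hy).2
      simpa [sub_eq_zero] using this
    have hne : y ≠ 1 := fun h ↦ hy1 (Subtype.ext h)
    refine ⟨Units.ofPowEqOne y l hy' hl.ne_zero, ?_⟩
    have : Fact l.Prime := ⟨hl⟩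
    apply orderOf_eq_prime
    · exact Units.pow_ofPowEqOne hy' hl.ne_zero
    · intro h
      exact hne (congrArg Units.val h)
  rcases eq_one_and_exists_pow_of_pow_eq hord φ ha hb hab hpow with
    ⟨n, rfl, rfl⟩ | ⟨n, rfl, rfl⟩
  · obtain ⟨m, hm⟩ := exists_card_pow_eq_of_pow_eq (F := F) (p := p) (n := n)
      fun y ↦ by simpa using hF y
    refine ⟨m, ?_⟩
    rw [hm]
    simp
  · obtain ⟨m, hm⟩ := exists_card_pow_eq_of_pow_eq (F := F) (p := p) (n := n)
      fun y ↦ by simpa using (hF y).symm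
    refine ⟨-m, ?_⟩
    rw [hm]
    simp

/-! ### Lifting Frobenius to the Galois group -/

/-- Lifting the Frobenius of a finite residue field to a Galois group. -/
theorem exists_gal_frobenius_integralClosure {A K₀ K : Type*} [CommRing A] [Field K₀] [Field K]
    [Algebra A K₀] [IsFractionRing A K₀] [IsIntegrallyClosed A] [Algebra K₀ K] [IsGalois K₀ K]
    [Algebra A K] [IsScalarTower A K₀ K] (Q : Ideal (integralClosure A K)) [Q.IsMaximal]
    [Finite (A ⧸ Q.under A)] :
    ∃ σ : Gal(K/K₀), ∀ b : integralClosure A K,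
      σ • b - b ^ Nat.card (A ⧸ Q.under A) ∈ Q := by
  have : SMulCommClass Gal(K/K₀) A K := ⟨fun g a x ↦ by
    rw [AlgEquiv.smul_def, AlgEquiv.smul_def, ← algebraMap_smul K₀ a x, map_smul,
      algebraMap_smul]⟩
  let : TopologicalSpace (integralClosure A K) := ⊥
  have : DiscreteTopology (integralClosure A K) := ⟨rfl⟩
  -- For the discrete topology continuity means open stabilizers, which holds because each element
  -- is algebraic over `K₀`.
  have : ContinuousSMul Gal(K/K₀) (integralClosure A K) := by
    rw [continuousSMul_iff_stabilizer_isOpen]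
    intro x
    convert stabilizer_isOpen_of_isIntegral (K := K₀) (x : K) using 1
    ext g
    simp [MulAction.mem_stabilizer_iff, Subtype.ext_iff]
  -- Normality enters here: an invariant element lies in `K₀` and is integral over `A`, hence lies
  -- in `A`.
  have : Algebra.IsInvariant A (integralClosure A K) Gal(K/K₀) := by
    constructor
    intro b hb
    have h1 : (b : K) ∈ Set.range (algebraMap K₀ K) := by
      rw [InfiniteGalois.mem_range_algebraMap_iff_fixed]
      exact fun g ↦ congrArg Subtype.val (hb g)
    obtain ⟨c, hc⟩ := h1
    have h2 : IsIntegral A c := by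
      rw [← isIntegral_algebraMap_iff (algebraMap K₀ K).injective, hc]
      exact b.2
    obtain ⟨a, rfl⟩ := IsIntegrallyClosed.isIntegral_iff.mp h2
    refine ⟨a, Subtype.ext ?_⟩
    rw [← hc, ← IsScalarTower.algebraMap_apply]
    rfl
  let P := Q.under A
  have : P.IsMaximal := Ideal.isMaximal_comap_of_isIntegral_of_isMaximal Q
  have : Finite (A ⧸ P) := ‹_›
  let := Ideal.Quotient.field P
  let := Ideal.Quotient.field Q
  have : Fintype (A ⧸ P) := Fintype.ofFinite _
  have : Algebra.IsAlgebraic (A ⧸ P) (integralClosure A K ⧸ Q) :=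
    Algebra.IsIntegral.isAlgebraic
  obtain ⟨σ, hσ⟩ := Ideal.Quotient.stabilizerHom_surjective_of_profinite (G := Gal(K/K₀)) P Q
    (FiniteField.frobeniusAlgEquivOfAlgebraic (A ⧸ P) (integralClosure A K ⧸ Q))
  refine ⟨σ, fun b ↦ ?_⟩
  have := DFunLike.congr_fun hσ (Ideal.Quotient.mk Q b)
  rw [← Ideal.Quotient.eq, map_pow, Nat.card_eq_fintype_card]
  exact this

/-- Transports the previous result to any model `B` of the integral closure and to given residue
fields. The action on `B` is expressed inside `K`, because `B` carries no Galois action here. -/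
theorem exists_gal_frobenius {A B K₀ K F k : Type*} [CommRing A] [CommRing B] [Field K₀] [Field K]
    [Algebra A K₀] [IsFractionRing A K₀] [IsIntegrallyClosed A] [Algebra K₀ K] [IsGalois K₀ K]
    [Algebra A K] [IsScalarTower A K₀ K] [Algebra A B] [Algebra B K] [IsScalarTower A B K]
    [IsIntegralClosure B A K] [Field F] [Finite F] [Field k] (e₀ : A →+* F)
    (he₀ : Function.Surjective e₀) (e : B →+* k) (he : Function.Surjective e) (i : F →+* k)
    (hi : e.comp (algebraMap A B) = i.comp e₀) :
    ∃ σ : Gal(K/K₀), ∀ b b' : B, algebraMap B K b' = σ (algebraMap B K b) →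
      e b' = e b ^ Nat.card F := by
  let E := IsIntegralClosure.equiv A B K (integralClosure A K)
  let e' : integralClosure A K →+* k := e.comp (E.symm : integralClosure A K →+* B)
  have he' : Function.Surjective e' := he.comp E.symm.surjective
  let Q := RingHom.ker e'
  have : Q.IsMaximal := RingHom.ker_isMaximal_of_surjective e' he'
  have hker : Q.under A = RingHom.ker e₀ := by
    ext a
    have h := DFunLike.congr_fun hi a
    simp only [RingHom.comp_apply] at h
    rw [Ideal.under, Ideal.mem_comap, RingHom.mem_ker, RingHom.mem_ker, ← map_eq_zero i, ← h]
    simp [e']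
  let E₀ : (A ⧸ Q.under A) ≃+* F :=
    (Ideal.quotEquivOfEq hker).trans (RingHom.quotientKerEquivOfSurjective he₀)
  have : Finite (A ⧸ Q.under A) := Finite.of_equiv F E₀.symm.toEquiv
  obtain ⟨σ, hσ⟩ := exists_gal_frobenius_integralClosure (K₀ := K₀) Q
  rw [Nat.card_congr E₀.toEquiv] at hσ
  refine ⟨σ, fun b b' h ↦ ?_⟩
  have h1 : σ • E b = E b' := by
    apply Subtype.ext
    change σ (algebraMap _ K (E b)) = algebraMap _ K (E b')
    rw [IsIntegralClosure.algebraMap_equiv, IsIntegralClosure.algebraMap_equiv, h]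
  have h2 := hσ (E b)
  rw [h1, RingHom.mem_ker, map_sub, sub_eq_zero, map_pow] at h2
  simpa [e'] using h2


namespace ArithScheme

/-! ### Stabilizers in the colimit -/

section Colimit

/-- The element `F_ν⁻¹(P)` of the colimit. -/
def FrobColim.mk {Y : Type u} [MulAction ℕ+ Y] (P : Y) (ν : ℕ+) : FrobColim Y :=
  Quotient.mk (frobSetoid Y) (P, ν)

/-- The index `ν` plays no role because the Frobenius maps commute: it can be absorbed into `μ`. -/
lemma FrobColim.mem_stabilizer_mk_iff {Y : Type u} [MulAction ℕ+ Y] (P : Y) (ν : ℕ+)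
    (q : {q : ℚ // 0 < q}) :
    q ∈ MulAction.stabilizer {q : ℚ // 0 < q} (FrobColim.mk P ν) ↔
      ∃ μ : ℕ+, (μ * posNum q) • P = (μ * posDen q) • P := by
  have h : q ∈ MulAction.stabilizer {q : ℚ // 0 < q} (FrobColim.mk P ν) ↔
      ∃ μ : ℕ+, (μ * ν) • posNum q • P = (μ * (posDen q * ν)) • P :=
    MulAction.mem_stabilizer_iff.trans Quotient.eq
  rw [h]
  constructor
  · rintro ⟨μ, h⟩
    refine ⟨μ * ν, ?_⟩
    rw [mul_smul, h]
    congr 1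
    ac_rfl
  · rintro ⟨μ, h⟩
    refine ⟨μ, ?_⟩
    rw [← mul_smul, show μ * ν * posNum q = ν * (μ * posNum q) by ac_rfl, mul_smul, h, ← mul_smul]
    congr 1
    ac_rfl

end Colimit

/-! ### Residue fields and characters at a fixed point -/

section FixedPoint

variable {X : Scheme.{u}}

/-- The endomorphism of the residue field at a fixed point `x` of `f`. -/
def residueFieldEnd (f : X ⟶ X) {x : X} (h : f x = x) : X.residueField x →+* X.residueField x :=
  ((X.residueFieldCongr h.symm).hom ≫ f.residueFieldMap x).hom

lemma evaluation_residueFieldCongr {x y : X} (h : x = y) {U : X.Opens} (hx : x ∈ U) (hy : y ∈ U)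
    (s : Γ(X, U)) :
    (X.residueFieldCongr h).hom (X.evaluation U x hx s) = X.evaluation U y hy s := by
  subst h
  simp

lemma residueFieldMap_evaluation {Y : Scheme.{u}} (f : X ⟶ Y) {x : X} {U : Y.Opens} {V : X.Opens}
    (hVU : V ≤ f ⁻¹ᵁ U) (hx : x ∈ V) (hfx : f x ∈ U) (s : Γ(Y, U)) :
    f.residueFieldMap x (Y.evaluation U (f x) hfx s) =
      X.evaluation V x hx (f.appLE U V hVU s) := by
  rw [Scheme.evaluation_naturality_apply]
  change X.residue x (X.presheaf.germ _ x _ _) = X.residue x (X.presheaf.germ _ x _ _)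
  rw [Scheme.Hom.appLE, CommRingCat.comp_apply]
  congr 1
  exact (X.presheaf.germ_res_apply (homOfLE hVU) x hx _).symm

lemma residueFieldEnd_evaluation (f : X ⟶ X) {x : X} (h : f x = x) {U : X.Opens}
    (hU : U ≤ f ⁻¹ᵁ U) (hx : x ∈ U) (s : Γ(X, U)) :
    residueFieldEnd f h (X.evaluation U x hx s) =
      X.evaluation U x hx (f.appLE U U hU s) := by
  have h1 : residueFieldEnd f h (X.evaluation U x hx s) =
      f.residueFieldMap x ((X.residueFieldCongr h.symm).hom (X.evaluation U x hx s)) := rfl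
  have hfx : f x ∈ U := hU hx
  rw [h1, evaluation_residueFieldCongr h.symm hx hfx, residueFieldMap_evaluation f hU hx]

lemma residueFieldEnd_comp_residueFieldMap {Y : Scheme.{u}} (f : X ⟶ X) (g : X ⟶ Y)
    (hfg : f ≫ g = g) {x : X} (h : f x = x) :
    (residueFieldEnd f h).comp (g.residueFieldMap x).hom = (g.residueFieldMap x).hom := by
  rw [residueFieldEnd, ← CommRingCat.hom_comp, ← Category.assoc,
    Scheme.Hom.residueFieldMap_congr' h.symm, Category.assoc]
  have h' := Scheme.Hom.residueFieldMap_congr hfg.symm x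
  rw [Scheme.residueFieldMap_comp] at h'
  exact congrArg CommRingCat.Hom.hom h'.symm

/-- Replaces an equality of dependent pairs by an equation between values, with the transport moved
to the residue fields. -/
lemma CharPoint.eq_iff {C : Type v} [Field C] {x y : X} (χ : ResChar C x) (ψ : ResChar C y) :
    (⟨x, χ⟩ : CharPoint X C) = ⟨y, ψ⟩ ↔ ∃ h : y = x, ∀ z : (X.residueField y)ˣ,
      ψ z = χ (Units.map ((X.residueFieldCongr h).hom.hom : _ →* _) z) := by
  constructor
  · intro h
    obtain ⟨rfl, h⟩ := Sigma.mk.inj_iff.mp h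
    obtain rfl := eq_of_heq h
    refine ⟨rfl, fun z ↦ ?_⟩
    congr 1
  · rintro ⟨rfl, h⟩
    congr 1
    ext z
    rw [h]
    congr 2

lemma CharPoint.map_eq_iff {C : Type v} [Field C] (f : X ⟶ X) {x : X} (χ ψ : ResChar C x) :
    CharPoint.map f ⟨x, χ⟩ = ⟨x, ψ⟩ ↔ ∃ h : f x = x, ∀ z : (X.residueField x)ˣ,
      ψ z = χ (Units.map (residueFieldEnd f h : _ →* _) z) := by
  rw [CharPoint.map, CharPoint.eq_iff]
  constructor
  · rintro ⟨h, h'⟩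
    exact ⟨h.symm, h'⟩
  · rintro ⟨h, h'⟩
    exact ⟨h.symm, h'⟩

end FixedPoint

/-! ### The stabilizer as a relation on the character -/

section Stabilizer

variable {X₀ : Scheme.{u}} [IsIntegral X₀] {K : Type u} [Field K] [Algebra X₀.functionField K]
  {C : Type v} [Field C] {E : CharCondition X₀ K C}

/-- The orbit of an element of `DotX E`. -/
def DotX₀.mk (P : DotX E) : DotX₀ E :=
  Quotient.mk (MulAction.orbitRel (Gal X₀ K)ᵐᵒᵖ (DotX E)) P

/-- The Frobenius maps leave the underlying point unchanged, so a `σ` matching the two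
representatives must fix it. -/
lemma DotX₀.smul_mk_eq_smul_mk_iff (P : DotX E) (a b : ℕ+) :
    a • DotX₀.mk P =
        b • DotX₀.mk P ↔
      ∃ (σ : Gal X₀ K) (h : galHom X₀ σ P.point.1 = P.point.1),
        ∀ z, P.point.2 z ^ (a : ℕ) =
          P.point.2 (Units.map (residueFieldEnd (galHom X₀ σ) h : _ →* _) z) ^ (b : ℕ) := by
  have h : a • DotX₀.mk P =
        b • DotX₀.mk P ↔
      ∃ σ : (Gal X₀ K)ᵐᵒᵖ, σ • b • P = a • P :=
    Quotient.eq (r := MulAction.orbitRel (Gal X₀ K)ᵐᵒᵖ (DotX E))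
  rw [h, MulOpposite.op_surjective.exists]
  refine exists_congr fun σ ↦ ?_
  rw [DotX.ext_iff]
  refine (CharPoint.map_eq_iff (galHom X₀ σ) (P.point.2.frob b) (P.point.2.frob a)).trans ?_
  refine exists_congr fun h ↦ forall_congr' fun z ↦ ?_
  rw [ResChar.frob, ResChar.frob, MonoidHom.comp_apply, MonoidHom.comp_apply, powMonoidHom_apply,
    powMonoidHom_apply, map_pow, map_pow]

lemma CheckX₀.exists_rep (P : CheckX₀ E) :
    ∃ (p : DotX E) (ν : ℕ+), P = FrobColim.mk (DotX₀.mk p) ν := by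
  obtain ⟨⟨⟨p⟩, ν⟩⟩ := P
  exact ⟨p, ν, rfl⟩

lemma mem_stabilizer_mk_mk_iff (P : DotX E) (ν : ℕ+) (q : {q : ℚ // 0 < q}) :
    q ∈ MulAction.stabilizer {q : ℚ // 0 < q} (FrobColim.mk (DotX₀.mk P) ν : CheckX₀ E) ↔
      ∃ (μ : ℕ+) (σ : Gal X₀ K) (h : galHom X₀ σ P.point.1 = P.point.1),
        ∀ z, P.point.2 z ^ ((μ : ℕ) * posNum q) =
          P.point.2 (Units.map (residueFieldEnd (galHom X₀ σ) h : _ →* _) z) ^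
            ((μ : ℕ) * posDen q) := by
  rw [FrobColim.mem_stabilizer_mk_iff]
  exact exists_congr fun μ ↦ DotX₀.smul_mk_eq_smul_mk_iff P _ _

end Stabilizer


/-! ### Fields of finite type over the integers -/

section Arithmetic

/-- Nonzero primes are maximal, and a nonzero integer is not divisible by a prime exceeding its
absolute value. -/
theorem isJacobsonRing_int : IsJacobsonRing ℤ := by
  rw [isJacobsonRing_iff_prime_eq]
  intro P hP
  by_cases h0 : P = ⊥
  · subst h0
    refine le_antisymm (fun n hn ↦ ?_) Ideal.le_jacobson
    rw [Ideal.mem_bot]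
    by_contra hne
    obtain ⟨p, hpn, hp⟩ := Nat.exists_infinite_primes (n.natAbs + 1)
    have hmax : (Ideal.span {(p : ℤ)}).IsMaximal :=
      PrincipalIdealRing.isMaximal_of_irreducible (Nat.prime_iff_prime_int.mp hp).irreducible
    have h1 : n ∈ Ideal.span {(p : ℤ)} := Ideal.mem_sInf.mp hn ⟨bot_le, hmax⟩
    rw [Ideal.mem_span_singleton, Int.natCast_dvd] at h1
    have := Nat.le_of_dvd (Int.natAbs_pos.mpr hne) h1
    omega
  · have := hP.isMaximal h0
    exact Ideal.jacobson_eq_self_of_isMaximal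

/-- A field that is finitely generated as a ring is finite. -/
theorem finite_of_finiteType_int (k : Type*) [Field k] [Algebra.FiniteType ℤ k] : Finite k := by
  have := isJacobsonRing_int
  have hfin : Module.Finite ℤ k := finite_of_finite_type_of_isJacobsonRing ℤ k
  obtain ⟨p, hp⟩ := CharP.exists k
  rcases CharP.char_is_prime_or_zero k p with hp' | rfl
  · refine Module.finite_of_fg_torsion k fun x ↦ ⟨⟨(p : ℤ), ?_⟩, ?_⟩
    · rw [mem_nonZeroDivisors_iff_ne_zero]
      exact_mod_cast hp'.ne_zero
    · rw [Submonoid.mk_smul, zsmul_eq_mul]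
      simp
  -- In characteristic zero `k` would be integral over the subring `ℤ`, making `ℤ` a field.
  · have : CharZero k := CharP.charP_to_charZero k
    exact (Int.not_isField (isField_of_isIntegral_of_isField (S := k)
      (RingHom.injective_int (algebraMap ℤ k)) (Field.toIsField k))).elim

end Arithmetic

/-! ### Evaluation of functions; closed points -/

section Evaluation

variable {X : Scheme.{u}} {U : X.Opens}

/-- Every element of the residue field is a fraction of values of functions on an affine open. -/
lemma exists_mul_evaluation_eq (hU : IsAffineOpen U) {x : X} (hx : x ∈ U) (y : X.residueField x) :
    ∃ a b : Γ(X, U), X.evaluation U x hx b ≠ 0 ∧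
      y * X.evaluation U x hx b = X.evaluation U x hx a := by
  obtain ⟨t, rfl⟩ := X.residue_surjective x y
  let := X.presheaf.algebra_section_stalk ⟨x, hx⟩
  have : IsLocalization.AtPrime (X.presheaf.stalk x) (hU.primeIdealOf ⟨x, hx⟩).asIdeal :=
    hU.isLocalization_stalk ⟨x, hx⟩
  obtain ⟨⟨a, b⟩, h⟩ := IsLocalization.surj (hU.primeIdealOf ⟨x, hx⟩).asIdeal.primeCompl t
  have hb := IsLocalization.map_units (X.presheaf.stalk x) b
  refine ⟨a, b, ?_, ?_⟩
  · exact (hb.map (X.residue x).hom).ne_zero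
  · have h' := congrArg (X.residue x) h
    rw [map_mul] at h'
    exact h'

/-- Elements of the residue field are fractions of values, and maximality inverts the denominators
modulo the kernel. -/
lemma evaluation_surjective_of_isMaximal (hU : IsAffineOpen U) {x : X} (hx : x ∈ U)
    (h : (RingHom.ker (X.evaluation U x hx).hom).IsMaximal) :
    Function.Surjective (X.evaluation U x hx) := by
  intro y
  obtain ⟨a, b, hb, hab⟩ := exists_mul_evaluation_eq hU hx y
  obtain ⟨c, hc⟩ := h.exists_inv (x := b) hb
  obtain ⟨i, hi, hc⟩ := hc
  have h1 : X.evaluation U x hx c * X.evaluation U x hx b = 1 := by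
    have h2 := congrArg (X.evaluation U x hx) hc
    have hi' : X.evaluation U x hx i = 0 := hi
    rwa [map_add, map_mul, map_one, hi', add_zero] at h2
  refine ⟨a * c, ?_⟩
  rw [map_mul, ← hab, mul_assoc, mul_comm (X.evaluation U x hx b), h1, mul_one]

lemma ker_evaluation (hU : IsAffineOpen U) {x : X} (hx : x ∈ U) :
    RingHom.ker (X.evaluation U x hx).hom = (hU.primeIdealOf ⟨x, hx⟩).asIdeal := by
  ext s
  have h1 : x ∈ X.basicOpen s ↔ s ∉ (hU.primeIdealOf ⟨x, hx⟩).asIdeal := by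
    rw [← PrimeSpectrum.mem_basicOpen, ← hU.fromSpec_preimage_basicOpen]
    change _ ↔ hU.fromSpec (hU.primeIdealOf ⟨x, hx⟩) ∈ X.basicOpen s
    rw [hU.fromSpec_primeIdealOf]
  rw [RingHom.mem_ker]
  refine (Scheme.evaluation_eq_zero_iff_notMem_basicOpen X x hx s).trans ?_
  rw [h1, not_not]

lemma evaluation_surjective_of_isClosed (hU : IsAffineOpen U) {x : X} (hx : x ∈ U)
    (h : IsClosed ({x} : Set X)) : Function.Surjective (X.evaluation U x hx) := by
  apply evaluation_surjective_of_isMaximal hU hx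
  rw [ker_evaluation hU hx]
  exact hU.primeIdealOf_isMaximal_of_isClosed ⟨x, hx⟩ h

/-- Two points of an affine open at which the same functions vanish are equal. -/
lemma eq_of_evaluation_eq_zero_iff (hU : IsAffineOpen U) {x y : X} (hx : x ∈ U) (hy : y ∈ U)
    (h : ∀ s, X.evaluation U x hx s = 0 ↔ X.evaluation U y hy s = 0) : x = y := by
  have h1 : hU.primeIdealOf ⟨x, hx⟩ = hU.primeIdealOf ⟨y, hy⟩ := by
    apply PrimeSpectrum.ext
    rw [← ker_evaluation hU hx, ← ker_evaluation hU hy]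
    ext s
    exact h s
  exact (hU.fromSpec_primeIdealOf ⟨x, hx⟩).symm.trans
    ((congrArg hU.fromSpec h1).trans (hU.fromSpec_primeIdealOf ⟨y, hy⟩))

/-- A point whose residue field has a torsion group of units is closed. -/
lemma isClosed_singleton_of_isOfFinOrder {x : X}
    (h : ∀ y : (X.residueField x)ˣ, IsOfFinOrder y) : IsClosed ({x} : Set X) := by
  rw [← closure_subset_iff_isClosed]
  intro y hy
  have hxy : x ⤳ y := specializes_iff_mem_closure.mpr hy
  obtain ⟨_, ⟨U, hU, rfl⟩, hyU, -⟩ := X.isBasis_affineOpens.exists_subset_of_mem_open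
    (Set.mem_univ y) isOpen_univ
  have hxU : x ∈ U := hxy.mem_open U.isOpen hyU
  -- If `s` vanishes at the specialization `y` but not at `x`, some `s ^ n - 1` vanishes at `x`,
  -- hence at `y`, where its value is `-1`.
  have key (s : Γ(X, U)) (hs : X.evaluation U y hyU s = 0) : X.evaluation U x hxU s = 0 := by
    by_contra hne
    obtain ⟨n, hn, h1⟩ := (h (Units.mk0 _ hne)).exists_pow_eq_one
    have h2 : X.evaluation U x hxU (s ^ n - 1) = 0 := by
      have := congrArg Units.val h1
      rw [Units.val_pow_eq_pow_val, Units.val_mk0, Units.val_one] at this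
      rw [map_sub, map_pow, map_one, this, sub_self]
    rw [Scheme.evaluation_eq_zero_iff_notMem_basicOpen] at h2
    have h3 : X.evaluation U y hyU (s ^ n - 1) = 0 := by
      rw [Scheme.evaluation_eq_zero_iff_notMem_basicOpen]
      exact fun h ↦ h2 (hxy.mem_open (X.basicOpen (s ^ n - 1)).isOpen h)
    rw [map_sub, map_pow, map_one, hs, zero_pow hn.ne', zero_sub, neg_eq_zero] at h3
    exact one_ne_zero h3
  refine Set.mem_singleton_iff.mpr (Eq.symm ?_)
  refine eq_of_evaluation_eq_zero_iff hU hxU hyU fun s ↦ ⟨fun hs ↦ ?_, key s⟩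
  rw [Scheme.evaluation_eq_zero_iff_notMem_basicOpen] at hs ⊢
  exact fun h ↦ hs (hxy.mem_open (X.basicOpen s).isOpen h)

/-- Evaluation at a closed point is onto, so the residue field is a ring of finite type over `ℤ`. -/
lemma finite_residueField_of_isClosed (s : X ⟶ Spec (CommRingCat.of (ULift.{u} ℤ)))
    [LocallyOfFiniteType s] {x : X} (h : IsClosed ({x} : Set X)) : Finite (X.residueField x) := by
  obtain ⟨_, ⟨U, hU, rfl⟩, hxU, -⟩ := X.isBasis_affineOpens.exists_subset_of_mem_open
    (Set.mem_univ x) isOpen_univ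
  have h1 := s.finiteType_appLE (isAffineOpen_top _) hU le_top
  have h2 : (((X.evaluation U x hxU).hom.comp (s.appLE ⊤ U le_top).hom).comp
      (Scheme.ΓSpecIso (CommRingCat.of (ULift.{u} ℤ))).inv.hom).FiniteType :=
    ((RingHom.FiniteType.of_surjective _ (evaluation_surjective_of_isClosed hU hxU h)).comp
      h1).comp (RingHom.FiniteType.of_surjective _
        (Scheme.ΓSpecIso (CommRingCat.of (ULift.{u} ℤ))).symm.commRingCatIsoToRingEquiv.surjective)
  have h3 := h2.comp (RingHom.FiniteType.of_surjective
    (ULift.ringEquiv.symm : ℤ ≃+* ULift.{u} ℤ).toRingHom ULift.ringEquiv.symm.surjective)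
  have h4 : Algebra.FiniteType ℤ (X.residueField x) := by
    rw [← RingHom.finiteType_algebraMap]
    convert h3
    exact Subsingleton.elim _ _
  exact finite_of_finiteType_int (X.residueField x)

end Evaluation

/-! ### Residue fields under integral morphisms -/

section IntegralHom

variable {X Y : Scheme.{u}} (f : X ⟶ Y) [IsIntegralHom f]

/-- Values of functions are integral over `κ(f x)`; over a field, integrality is inherited by their
fractions. -/
lemma isIntegral_residueFieldMap (x : X) : (f.residueFieldMap x).hom.IsIntegral := by
  obtain ⟨_, ⟨U, hU, rfl⟩, hxU, -⟩ := Y.isBasis_affineOpens.exists_subset_of_mem_open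
    (Set.mem_univ (f x)) isOpen_univ
  have hV : IsAffineOpen (f ⁻¹ᵁ U) := hU.preimage f
  have hint : (f.app U).hom.IsIntegral := IsIntegralHom.isIntegral_app f U hU
  have key (a : Γ(X, f ⁻¹ᵁ U)) :
      (f.residueFieldMap x).hom.IsIntegralElem (X.evaluation (f ⁻¹ᵁ U) x hxU a) := by
    obtain ⟨p, hp, hpa⟩ := hint a
    refine ⟨p.map (Y.evaluation U (f x) hxU).hom, hp.map _, ?_⟩
    rw [Polynomial.eval₂_map, ← CommRingCat.hom_comp, Scheme.evaluation_naturality,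
      CommRingCat.hom_comp]
    refine (Polynomial.hom_eval₂ p _ (X.evaluation (f ⁻¹ᵁ U) x hxU).hom a).symm.trans ?_
    rw [hpa, map_zero]
  intro y
  obtain ⟨a, b, hb, hab⟩ := exists_mul_evaluation_eq hV hxU y
  have ha := key a
  have hb' := key b
  algebraize [(f.residueFieldMap x).hom]
  rw [eq_div_of_mul_eq hb hab, div_eq_mul_inv]
  exact IsIntegral.mul ha (IsIntegral.inv hb')

/-- In an integral extension a prime lying over a maximal ideal is maximal. -/
lemma evaluation_surjective_of_isClosed_map {U : Y.Opens} (hU : IsAffineOpen U) {x : X}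
    (hx : f x ∈ U) (h : IsClosed ({f x} : Set Y)) :
    Function.Surjective (X.evaluation (f ⁻¹ᵁ U) x hx) := by
  apply evaluation_surjective_of_isMaximal (hU.preimage f) hx
  have hint : (f.app U).hom.IsIntegral := IsIntegralHom.isIntegral_app f U hU
  have hprime : (RingHom.ker (X.evaluation (f ⁻¹ᵁ U) x hx).hom).IsPrime := RingHom.ker_isPrime _
  have h1 : (RingHom.ker (X.evaluation (f ⁻¹ᵁ U) x hx).hom).comap (f.app U).hom =
      RingHom.ker (Y.evaluation U (f x) hx).hom := by
    ext s
    rw [Ideal.mem_comap, RingHom.mem_ker, RingHom.mem_ker,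
      ← map_eq_zero (f.residueFieldMap x).hom]
    exact iff_of_eq (congrArg (· = 0) (Scheme.evaluation_naturality_apply f x hx s).symm)
  algebraize [(f.app U).hom]
  refine Ideal.isMaximal_of_isIntegral_of_isMaximal_comap (R := Γ(Y, U)) _ ?_
  change Ideal.IsMaximal (Ideal.comap (f.app U).hom _)
  rw [h1]
  exact RingHom.ker_isMaximal_of_surjective _ (evaluation_surjective_of_isClosed hU hx h)

end IntegralHom


/-! ### Functions on the normalization as the integral closure in `K` -/

section Sections

/-- The property is local at maximal ideals, and the localizations there are stalks. -/
lemma isIntegrallyClosed_section {X : Scheme.{u}} [IsIntegral X]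
    (normal : ∀ x : X, IsIntegrallyClosed (X.presheaf.stalk x)) {U : X.Opens}
    (hU : IsAffineOpen U) [Nonempty U] : IsIntegrallyClosed Γ(X, U) := by
  refine IsIntegrallyClosed.of_localization_maximal fun P _ hP ↦ ?_
  let y : Spec Γ(X, U) := (⟨P, hP.isPrime⟩ : PrimeSpectrum Γ(X, U))
  have hy : hU.fromSpec y ∈ U := by
    rw [← SetLike.mem_coe, ← hU.range_fromSpec]
    exact ⟨y, rfl⟩
  let := X.presheaf.algebra_section_stalk ⟨hU.fromSpec y, hy⟩
  have : IsLocalization.AtPrime (X.presheaf.stalk (hU.fromSpec y)) P :=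
    hU.isLocalization_stalk' y hy
  have := normal (hU.fromSpec y)
  exact IsIntegrallyClosed.of_equiv
    (IsLocalization.algEquiv P.primeCompl (X.presheaf.stalk (hU.fromSpec y))
      (Localization.AtPrime P)).toRingEquiv

lemma top_le_fromSpecStalk_preimage {X : Scheme.{u}} {U : X.Opens} {x : X} (hx : x ∈ U) :
    ⊤ ≤ X.fromSpecStalk x ⁻¹ᵁ U := by
  intro y _
  have h : X.fromSpecStalk x y ∈ Set.range (X.fromSpecStalk x) := ⟨y, rfl⟩
  rw [Scheme.range_fromSpecStalk] at h
  have h' : X.fromSpecStalk x y ⤳ x := h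
  exact h'.mem_open U.isOpen hx

lemma fromSpecStalk_appLE {X : Scheme.{u}} {U : X.Opens} {x : X} (hx : x ∈ U) :
    (X.fromSpecStalk x).appLE U ⊤ (top_le_fromSpecStalk_preimage hx) ≫
      (Scheme.ΓSpecIso (X.presheaf.stalk x)).hom = X.presheaf.germ U x hx := by
  rw [Scheme.Hom.appLE, Scheme.fromSpecStalk_app hx]
  simp only [Category.assoc, ← Functor.map_comp_assoc]
  rw [← op_comp, Subsingleton.elim (homOfLE _ ≫ homOfLE _) (𝟙 _), op_id,
    CategoryTheory.Functor.map_id, Category.id_comp, Iso.inv_hom_id, Category.comp_id]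

lemma appLE_SpecMap_comp {X : Scheme.{u}} {R S : CommRingCat.{u}} (φ : R ⟶ S) (g : Spec R ⟶ X)
    {U : X.Opens} (h : ⊤ ≤ g ⁻¹ᵁ U) (h' : ⊤ ≤ (Spec.map φ ≫ g) ⁻¹ᵁ U) :
    (Spec.map φ ≫ g).appLE U ⊤ h' ≫ (Scheme.ΓSpecIso S).hom =
      g.appLE U ⊤ h ≫ (Scheme.ΓSpecIso R).hom ≫ φ := by
  rw [← Scheme.ΓSpecIso_naturality, ← Category.assoc, Scheme.Hom.appTop,
    ← Scheme.Hom.appLE_comp_appLE (Spec.map φ) g U ⊤ ⊤ h le_top]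
  congr 2

variable (X₀ : Scheme.{u}) [IsIntegral X₀] (K : Type u) [Field K] [Algebra X₀.functionField K]

lemma genericPoint_mem (U : X₀.Opens) [Nonempty U] : genericPoint X₀ ∈ U :=
  ((genericPoint_spec X₀).mem_open_set_iff U.isOpen).mpr (by simpa using ‹Nonempty U›)

lemma specTo_preimage (U : X₀.Opens) [Nonempty U] : specTo X₀ K ⁻¹ᵁ U = ⊤ := by
  rw [eq_top_iff, specTo, Scheme.Hom.comp_preimage]
  intro y _
  exact top_le_fromSpecStalk_preimage (genericPoint_mem X₀ U) trivial

lemma toNormalization_preimage (U : X₀.Opens) [Nonempty U] :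
    (specTo X₀ K).toNormalization ⁻¹ᵁ normProj X₀ K ⁻¹ᵁ U = ⊤ := by
  rw [← Scheme.Hom.comp_preimage, Scheme.Hom.toNormalization_fromNormalization, specTo_preimage]

/-- The map from sections of a scheme to `K` induced by a morphism from `Spec K`. -/
def sectionsMap {K : Type u} [Field K] {X : Scheme.{u}} (g : Spec (CommRingCat.of K) ⟶ X)
    (U : X.Opens) (h : g ⁻¹ᵁ U = ⊤) : Γ(X, U) →+* K :=
  (g.appLE U ⊤ h.ge ≫ (Scheme.ΓSpecIso (CommRingCat.of K)).hom).hom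

lemma sectionsMap_comp {K : Type u} [Field K] {X Y : Scheme.{u}} (g : Spec (CommRingCat.of K) ⟶ X)
    (f : X ⟶ Y) {U : Y.Opens} {V : X.Opens} (hVU : V ≤ f ⁻¹ᵁ U) (hV : g ⁻¹ᵁ V = ⊤)
    (hU : (g ≫ f) ⁻¹ᵁ U = ⊤) (s : Γ(Y, U)) :
    sectionsMap (g ≫ f) U hU s = sectionsMap g V hV (f.appLE U V hVU s) := by
  have : sectionsMap (g ≫ f) U hU = (sectionsMap g V hV).comp (f.appLE U V hVU).hom := by
    rw [sectionsMap, sectionsMap, ← Scheme.Hom.appLE_comp_appLE g f U V ⊤ hVU hV.ge]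
    rfl
  rw [this]
  rfl

lemma sectionsMap_SpecMap {K : Type u} [Field K] {X : Scheme.{u}} {R : CommRingCat.{u}}
    (φ : R ⟶ CommRingCat.of K) (g : Spec R ⟶ X) {U : X.Opens} (h : ⊤ ≤ g ⁻¹ᵁ U)
    (h' : (Spec.map φ ≫ g) ⁻¹ᵁ U = ⊤) (s : Γ(X, U)) :
    sectionsMap (Spec.map φ ≫ g) U h' s = φ ((Scheme.ΓSpecIso R).hom (g.appLE U ⊤ h s)) := by
  rw [sectionsMap, appLE_SpecMap_comp φ g h h'.ge]
  rfl

lemma sectionsMap_specTo (U : X₀.Opens) [Nonempty U] (s : Γ(X₀, U)) :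
    sectionsMap (specTo X₀ K) U (specTo_preimage X₀ K U) s =
      algebraMap X₀.functionField K (algebraMap Γ(X₀, U) X₀.functionField s) := by
  refine (sectionsMap_SpecMap (CommRingCat.ofHom (algebraMap X₀.functionField K))
    (X₀.fromSpecStalk (genericPoint X₀))
    (top_le_fromSpecStalk_preimage (genericPoint_mem X₀ U)) _ s).trans ?_
  have h := ConcreteCategory.congr_hom (fromSpecStalk_appLE (genericPoint_mem X₀ U)) s
  exact congrArg (algebraMap X₀.functionField K) h

/-- The restriction of a function on `𝔛` to the generic point. -/
def sectionsToField (U : X₀.Opens) [Nonempty U] :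
    Γ(normalizationIn X₀ K, normProj X₀ K ⁻¹ᵁ U) →+* K :=
  sectionsMap (specTo X₀ K).toNormalization (normProj X₀ K ⁻¹ᵁ U)
    (toNormalization_preimage X₀ K U)

lemma sectionsMap_congr {K : Type u} [Field K] {X : Scheme.{u}}
    {g g' : Spec (CommRingCat.of K) ⟶ X}
    (e : g = g') {U : X.Opens} (h : g ⁻¹ᵁ U = ⊤) (h' : g' ⁻¹ᵁ U = ⊤) :
    sectionsMap g U h = sectionsMap g' U h' := by
  subst e
  rfl

lemma sectionsToField_app (U : X₀.Opens) [Nonempty U] (s : Γ(X₀, U)) :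
    sectionsToField X₀ K U ((normProj X₀ K).app U s) =
      algebraMap X₀.functionField K (algebraMap Γ(X₀, U) X₀.functionField s) := by
  have e : (specTo X₀ K).toNormalization ≫ normProj X₀ K = specTo X₀ K :=
    Scheme.Hom.toNormalization_fromNormalization _
  have hU := specTo_preimage X₀ K U
  have hU' : ((specTo X₀ K).toNormalization ≫ normProj X₀ K) ⁻¹ᵁ U = ⊤ := by rw [e, hU]
  rw [← sectionsMap_specTo, ← sectionsMap_congr e hU' hU,
    sectionsMap_comp _ _ le_rfl (toNormalization_preimage X₀ K U) hU', Scheme.Hom.app_eq_appLE]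
  rfl

/-- Reads `toNormalization_galHom` on functions: `Spec K ⟶ 𝔛` intertwines `Spec σ` with `galHom X₀
σ`. -/
lemma sectionsToField_galHom (σ : Gal X₀ K) (U : X₀.Opens) [Nonempty U]
    (h : normProj X₀ K ⁻¹ᵁ U ≤ galHom X₀ σ ⁻¹ᵁ normProj X₀ K ⁻¹ᵁ U)
    (b : Γ(normalizationIn X₀ K, normProj X₀ K ⁻¹ᵁ U)) :
    sectionsToField X₀ K U ((galHom X₀ σ).appLE _ _ h b) = σ (sectionsToField X₀ K U b) := by
  have hV := toNormalization_preimage X₀ K U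
  have h2 : (specGal X₀ σ ≫ (specTo X₀ K).toNormalization) ⁻¹ᵁ normProj X₀ K ⁻¹ᵁ U = ⊤ := by
    rw [Scheme.Hom.comp_preimage, hV]
    rfl
  have h1 : ((specTo X₀ K).toNormalization ≫ galHom X₀ σ) ⁻¹ᵁ normProj X₀ K ⁻¹ᵁ U = ⊤ := by
    rw [toNormalization_galHom, h2]
  rw [sectionsToField, ← sectionsMap_comp _ _ h hV h1,
    sectionsMap_congr (toNormalization_galHom X₀ σ) h1 h2]
  exact sectionsMap_SpecMap (CommRingCat.ofHom (σ : K →+* K)) _ hV.ge h2 b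

/-- The evaluation of functions on an open subset of `Spec K` that is everything. -/
def evalSpecField {K : Type u} [Field K] (W : (Spec (CommRingCat.of K)).Opens) (hW : W = ⊤) :
    Γ(Spec (CommRingCat.of K), W) →+* K :=
  ((Spec (CommRingCat.of K)).presheaf.map (homOfLE hW.ge).op ≫
    (Scheme.ΓSpecIso (CommRingCat.of K)).hom).hom

lemma evalSpecField_bijective {K : Type u} [Field K] {W : (Spec (CommRingCat.of K)).Opens}
    (hW : W = ⊤) : Function.Bijective (evalSpecField W hW) := by
  have h : IsIso ((Spec (CommRingCat.of K)).presheaf.map (homOfLE hW.ge).op ≫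
      (Scheme.ΓSpecIso (CommRingCat.of K)).hom) := by
    subst hW
    rw [Subsingleton.elim (homOfLE _) (𝟙 _), op_id, CategoryTheory.Functor.map_id,
      Category.id_comp]
    infer_instance
  exact ConcreteCategory.bijective_of_isIso _

lemma sectionsMap_eq_evalSpecField {K : Type u} [Field K] {X : Scheme.{u}}
    (g : Spec (CommRingCat.of K) ⟶ X) {U : X.Opens} (h : g ⁻¹ᵁ U = ⊤)
    {W : (Spec (CommRingCat.of K)).Opens} (hW : W = ⊤) (hWU : W ≤ g ⁻¹ᵁ U) (s : Γ(X, U)) :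
    sectionsMap g U h s = evalSpecField W hW (g.appLE U W hWU s) := by
  subst hW
  have e : sectionsMap g U h = (evalSpecField ⊤ rfl).comp (g.appLE U ⊤ hWU).hom := by
    rw [sectionsMap, evalSpecField, ← CommRingCat.hom_comp, Scheme.Hom.appLE_map_assoc]
  rw [e]
  rfl

/-- The sections of the normalization over an affine open, as functions on the preimage in
`Spec K` that are integral. -/
lemma exists_sectionsEquiv {U : X₀.Opens} (hU : IsAffineOpen U) [Nonempty U] :
    letI := ((specTo X₀ K).app U).hom.toAlgebra
    ∃ e : Γ(normalizationIn X₀ K, normProj X₀ K ⁻¹ᵁ U) ≃+*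
        integralClosure Γ(X₀, U) Γ(Spec (CommRingCat.of K), specTo X₀ K ⁻¹ᵁ U),
      ∀ b, sectionsToField X₀ K U b =
        evalSpecField (specTo X₀ K ⁻¹ᵁ U) (specTo_preimage X₀ K U) (e b) := by
  let := ((specTo X₀ K).app U).hom.toAlgebra
  refine ⟨((specTo X₀ K).normalizationObjIso hU).commRingCatIsoToRingEquiv, fun b ↦ ?_⟩
  have h := ConcreteCategory.congr_hom
    (Scheme.Hom.normalizationObjIso_hom_val (specTo X₀ K) hU) b
  refine (sectionsMap_eq_evalSpecField (specTo X₀ K).toNormalization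
    (toNormalization_preimage X₀ K U) (specTo_preimage X₀ K U) ?_ b).trans ?_
  · rw [← Scheme.Hom.comp_preimage, Scheme.Hom.toNormalization_fromNormalization]
  · exact congrArg (evalSpecField (specTo X₀ K ⁻¹ᵁ U) (specTo_preimage X₀ K U)) h.symm

lemma sectionsToField_injective {U : X₀.Opens} (hU : IsAffineOpen U) [Nonempty U] :
    Function.Injective (sectionsToField X₀ K U) := by
  let := ((specTo X₀ K).app U).hom.toAlgebra
  obtain ⟨e, he⟩ := exists_sectionsEquiv X₀ K hU
  intro b c h
  rw [he, he] at h
  exact e.injective (Subtype.ext ((evalSpecField_bijective _).injective h))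

/-- Together with `sectionsToField_injective` this provides the `IsIntegralClosure` structure needed
to lift Frobenius. -/
lemma isIntegralElem_iff_exists_sectionsToField {U : X₀.Opens} (hU : IsAffineOpen U) [Nonempty U]
    (y : K) :
    ((algebraMap X₀.functionField K).comp
        (algebraMap Γ(X₀, U) X₀.functionField)).IsIntegralElem y ↔
      ∃ b, sectionsToField X₀ K U b = y := by
  let := ((specTo X₀ K).app U).hom.toAlgebra
  obtain ⟨e, he⟩ := exists_sectionsEquiv X₀ K hU
  have hr := evalSpecField_bijective (specTo_preimage X₀ K U)
  have hcomp : (algebraMap X₀.functionField K).comp (algebraMap Γ(X₀, U) X₀.functionField) =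
      (evalSpecField _ (specTo_preimage X₀ K U)).comp
        (algebraMap Γ(X₀, U) Γ(Spec (CommRingCat.of K), specTo X₀ K ⁻¹ᵁ U)) := by
    ext s
    refine (sectionsMap_specTo X₀ K U s).symm.trans ?_
    refine (sectionsMap_eq_evalSpecField _ _ (specTo_preimage X₀ K U) le_rfl s).trans ?_
    rw [← Scheme.Hom.app_eq_appLE]
    rfl
  have hint (t : Γ(Spec (CommRingCat.of K), specTo X₀ K ⁻¹ᵁ U)) :
      ((algebraMap X₀.functionField K).comp (algebraMap Γ(X₀, U) X₀.functionField)).IsIntegralElem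
        (evalSpecField _ (specTo_preimage X₀ K U) t) ↔ _root_.IsIntegral Γ(X₀, U) t := by
    rw [hcomp]
    refine exists_congr fun p ↦ and_congr_right fun _ ↦ ?_
    rw [← Polynomial.hom_eval₂, map_eq_zero_iff _ hr.injective]
  constructor
  · intro hy
    obtain ⟨t, rfl⟩ := hr.surjective y
    obtain ⟨b, hb⟩ := e.surjective ⟨t, (hint t).mp hy⟩
    exact ⟨b, by rw [he, hb]⟩
  · rintro ⟨b, rfl⟩
    rw [he]
    exact (hint _).mpr (e b).2

end Sections


/-! ### The normalization over a closed point -/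

section ClosedPoints

lemma exists_isAffineOpen_mem {X : Scheme.{u}} (x : X) :
    ∃ U : X.Opens, IsAffineOpen U ∧ x ∈ U := by
  obtain ⟨_, ⟨U, hU, rfl⟩, hxU, -⟩ := X.isBasis_affineOpens.exists_subset_of_mem_open
    (Set.mem_univ x) isOpen_univ
  exact ⟨U, hU, hxU⟩

variable {X₀ : Scheme.{u}} [IsIntegral X₀] {K : Type u} [Field K] [Algebra X₀.functionField K]

/-- Over a closed point, the residue fields of the normalization in a radically closed field are
radically closed. -/
lemma splits_X_pow_sub_C_residueField
    (radicial : ∀ N : ℕ, 0 < N → ∀ a : K,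
      (Polynomial.X ^ N - Polynomial.C a : Polynomial K).Splits)
    {x : normalizationIn X₀ K} (hx : IsClosed ({normProj X₀ K x} : Set X₀)) {N : ℕ} (hN : 0 < N)
    (y : (normalizationIn X₀ K).residueField x) :
    (Polynomial.X ^ N - Polynomial.C y :
      Polynomial ((normalizationIn X₀ K).residueField x)).Splits := by
  obtain ⟨U, hU, hxU⟩ := exists_isAffineOpen_mem (normProj X₀ K x)
  have : Nonempty U := ⟨⟨_, hxU⟩⟩
  obtain ⟨b, rfl⟩ := evaluation_surjective_of_isClosed_map (normProj X₀ K) hU hxU hx y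
  have hinj := sectionsToField_injective X₀ K hU
  -- The roots in `K` have an integral `N`-th power, so they are integral and come from functions;
  -- the factorization can then be evaluated at `x`.
  have hsplit : (Polynomial.X ^ N - Polynomial.C b).Splits := by
    refine Polynomial.Splits.of_splits_map_of_injective hinj ?_ fun a ha ↦ ?_
    · simpa using radicial N hN (sectionsToField X₀ K U b)
    · have ha' : a ^ N = sectionsToField X₀ K U b := by
        have := Polynomial.isRoot_of_mem_roots ha
        simpa [sub_eq_zero] using this
      have hb := (isIntegralElem_iff_exists_sectionsToField X₀ K hU _).mpr ⟨b, rfl⟩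
      refine (isIntegralElem_iff_exists_sectionsToField X₀ K hU a).mp ?_
      rw [← ha'] at hb
      algebraize [(algebraMap X₀.functionField K).comp (algebraMap Γ(X₀, U) X₀.functionField)]
      exact IsIntegral.of_pow hN hb
  have := hsplit.map ((normalizationIn X₀ K).evaluation (normProj X₀ K ⁻¹ᵁ U) x hxU).hom
  simpa using this

/-- Over a closed point, the Frobenius of the residue field of `X₀` is induced by an element of the
Galois group. -/
lemma exists_galHom_residueFieldEnd_eq_pow [IsGalois X₀.functionField K]
    (normal : ∀ x : X₀, IsIntegrallyClosed (X₀.presheaf.stalk x))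
    {x : normalizationIn X₀ K} (hx : IsClosed ({normProj X₀ K x} : Set X₀))
    [Finite (X₀.residueField (normProj X₀ K x))] :
    ∃ (σ : Gal X₀ K) (h : galHom X₀ σ x = x), ∀ y,
      residueFieldEnd (galHom X₀ σ) h y = y ^ Nat.card (X₀.residueField (normProj X₀ K x)) := by
  obtain ⟨U, hU, hxU⟩ := exists_isAffineOpen_mem (normProj X₀ K x)
  have : Nonempty U := ⟨⟨_, hxU⟩⟩
  have hsurj := evaluation_surjective_of_isClosed_map (normProj X₀ K) hU hxU hx
  have hsurj₀ := evaluation_surjective_of_isClosed hU hxU hx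
  have := isIntegrallyClosed_section normal hU
  have := functionField_isFractionRing_of_isAffineOpen X₀ U hU
  let : Algebra Γ(X₀, U) K :=
    ((algebraMap X₀.functionField K).comp (algebraMap Γ(X₀, U) X₀.functionField)).toAlgebra
  let : Algebra Γ(X₀, U) Γ(normalizationIn X₀ K, normProj X₀ K ⁻¹ᵁ U) :=
    ((normProj X₀ K).app U).hom.toAlgebra
  let : Algebra Γ(normalizationIn X₀ K, normProj X₀ K ⁻¹ᵁ U) K :=
    (sectionsToField X₀ K U).toAlgebra
  have : IsScalarTower Γ(X₀, U) X₀.functionField K := .of_algebraMap_eq' rfl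
  have : IsScalarTower Γ(X₀, U) Γ(normalizationIn X₀ K, normProj X₀ K ⁻¹ᵁ U) K :=
    .of_algebraMap_eq fun s ↦ (sectionsToField_app X₀ K U s).symm
  have : IsIntegralClosure Γ(normalizationIn X₀ K, normProj X₀ K ⁻¹ᵁ U) Γ(X₀, U) K :=
    ⟨sectionsToField_injective X₀ K hU,
      fun {y} ↦ isIntegralElem_iff_exists_sectionsToField X₀ K hU y⟩
  obtain ⟨σ, hσ⟩ := exists_gal_frobenius (K₀ := X₀.functionField) (K := K)
    (X₀.evaluation U (normProj X₀ K x) hxU).hom hsurj₀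
    ((normalizationIn X₀ K).evaluation (normProj X₀ K ⁻¹ᵁ U) x hxU).hom hsurj
    ((normProj X₀ K).residueFieldMap x).hom
    (congrArg CommRingCat.Hom.hom
      (Scheme.evaluation_naturality (normProj X₀ K) x hxU)).symm
  have hle : normProj X₀ K ⁻¹ᵁ U ≤ galHom X₀ σ ⁻¹ᵁ normProj X₀ K ⁻¹ᵁ U := by
    rw [← Scheme.Hom.comp_preimage, galHom_normProj]
  have key (b : Γ(normalizationIn X₀ K, normProj X₀ K ⁻¹ᵁ U)) :
      (normalizationIn X₀ K).evaluation (normProj X₀ K ⁻¹ᵁ U) x hxU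
        ((galHom X₀ σ).appLE _ _ hle b) =
      (normalizationIn X₀ K).evaluation (normProj X₀ K ⁻¹ᵁ U) x hxU b ^
        Nat.card (X₀.residueField (normProj X₀ K x)) :=
    hσ _ _ (sectionsToField_galHom X₀ K σ U hle b)
  -- A function `b` vanishes at the image of `x` iff its pullback, whose value at `x` is `b(x) ^ N`,
  -- vanishes at `x`.
  have hfix : galHom X₀ σ x = x := by
    have hσx : galHom X₀ σ x ∈ normProj X₀ K ⁻¹ᵁ U := hle (show x ∈ normProj X₀ K ⁻¹ᵁ U from hxU)
    refine eq_of_evaluation_eq_zero_iff (hU.preimage (normProj X₀ K)) hσx hxU fun b ↦ ?_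
    have h := (residueFieldMap_evaluation (galHom X₀ σ) hle hxU hσx b).trans (key b)
    rw [← map_eq_zero ((galHom X₀ σ).residueFieldMap x).hom]
    exact (iff_of_eq (congrArg (· = 0) h)).trans (pow_eq_zero_iff Nat.card_pos.ne')
  refine ⟨σ, hfix, fun y ↦ ?_⟩
  obtain ⟨b, rfl⟩ := hsurj y
  rw [residueFieldEnd_evaluation _ hfix hle hxU, key]

lemma exists_iterate_residueFieldEnd_eq {σ : Gal X₀ K} {x : normalizationIn X₀ K}
    (h : galHom X₀ σ x = x) (y : (normalizationIn X₀ K).residueField x) :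
    ∃ n : ℕ, 0 < n ∧ (residueFieldEnd (galHom X₀ σ) h)^[n] y = y :=
  exists_iterate_eq_of_isIntegral ((normProj X₀ K).residueFieldMap x).hom _
    (residueFieldEnd_comp_residueFieldMap _ _ (galHom_normProj X₀ σ) h) y
    (isIntegral_residueFieldMap (normProj X₀ K) x y)

end ClosedPoints

/-! ### Computation of the stabilizers -/

section Main

variable {X₀ : Scheme.{u}} [IsIntegral X₀] {K : Type u} [Field K] [Algebra X₀.functionField K]
  {C : Type v} [Field C] {E : CharCondition X₀ K C}

/-- A point of `CheckX₀` with a nontrivial stabilizer lies over a closed point. -/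
lemma isClosed_of_mem_stabilizer {P : DotX E} {ν : ℕ+} {q : {q : ℚ // 0 < q}} (hq : q ≠ 1)
    (h : q ∈ MulAction.stabilizer {q : ℚ // 0 < q} (FrobColim.mk (DotX₀.mk P) ν : CheckX₀ E)) :
    IsClosed ({normProj X₀ K P.point.1} : Set X₀) := by
  obtain ⟨μ, σ, hσ, hχ⟩ := (mem_stabilizer_mk_mk_iff P ν q).mp h
  set a := (μ : ℕ) * posNum q with ha
  set b := (μ : ℕ) * posDen q with hb
  have hab : a ≠ b := by
    intro hab
    have h1 : (posNum q : ℕ) = posDen q := Nat.eq_of_mul_eq_mul_left μ.pos hab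
    apply hq
    rw [Subtype.ext_iff, ← posNum_div_posDen q, h1]
    exact div_self (by positivity)
  have hiter (n : ℕ) (y : ((normalizationIn X₀ K).residueField P.point.1)ˣ) :
      P.point.2 y ^ a ^ n =
        P.point.2 ((Units.map (residueFieldEnd (galHom X₀ σ) hσ : _ →* _))^[n] y) ^ b ^ n := by
    induction n generalizing y with
    | zero => simp
    | succ n ih =>
      rw [pow_succ a, mul_comm, pow_mul, hχ, ← pow_mul, mul_comm b, pow_mul, ih, ← pow_mul,
        ← pow_succ, Function.iterate_succ_apply]
  have hroot (y : ((normalizationIn X₀ K).residueField P.point.1)ˣ) :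
      IsOfFinOrder (P.point.2 y) := by
    obtain ⟨n, hn, hy⟩ := exists_iterate_residueFieldEnd_eq hσ
      (y : (normalizationIn X₀ K).residueField P.point.1)
    have hy' : (Units.map (residueFieldEnd (galHom X₀ σ) hσ : _ →* _))^[n] y = y := by
      have hsemi : Function.Semiconj Units.val
        (Units.map (residueFieldEnd (galHom X₀ σ) hσ : _ →* _))
        (residueFieldEnd (galHom X₀ σ) hσ) := fun _ ↦ rfl
      exact Units.ext ((hsemi.iterate_right n y).trans hy)
    -- Once the orbit closes up, `χ y` has two equal powers with distinct exponents `a ^ n` and `b ^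
    -- n`.
    have h1 := hiter n y
    rw [hy'] at h1
    have hne : a ^ n ≠ b ^ n := fun h ↦ hab (Nat.pow_left_injective hn.ne' h)
    by_contra hinf
    exact hne (injective_pow_iff_not_isOfFinOrder.mpr hinf h1)
  -- The second half of `MaxCondition` makes `κ(x)ˣ` torsion, and `κ(π x)ˣ` embeds in it.
  have htors := (E.maxCondition _ _ P.holds).2 hroot
  apply isClosed_singleton_of_isOfFinOrder
  intro y
  have h1 := htors (Units.map (((normProj X₀ K).residueFieldMap P.point.1).hom : _ →* _) y)
  rw [isOfFinOrder_iff_pow_eq_one] at h1 ⊢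
  obtain ⟨n, hn, h1⟩ := h1
  refine ⟨n, hn, ?_⟩
  rw [← map_pow] at h1
  exact Units.map_injective ((normProj X₀ K).residueFieldMap P.point.1).hom.injective
    (h1.trans (map_one _).symm)

/-- The stabilizer is a subgroup, so it suffices to treat `N`; a `σ` inducing Frobenius satisfies
the criterion with `μ = 1`. -/
lemma card_zpow_mem_stabilizer [IsGalois X₀.functionField K]
    (normal : ∀ x : X₀, IsIntegrallyClosed (X₀.presheaf.stalk x)) {P : DotX E} (ν : ℕ+)
    (hx : IsClosed ({normProj X₀ K P.point.1} : Set X₀))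
    [Finite (X₀.residueField (normProj X₀ K P.point.1))] {q : {q : ℚ // 0 < q}} {n : ℤ}
    (hq : (q : ℚ) = (Nat.card (X₀.residueField (normProj X₀ K P.point.1)) : ℚ) ^ n) :
    q ∈ MulAction.stabilizer {q : ℚ // 0 < q} (FrobColim.mk (DotX₀.mk P) ν : CheckX₀ E) := by
  set N := Nat.card (X₀.residueField (normProj X₀ K P.point.1)) with hN
  have hN0 : 0 < N := Nat.card_pos
  let r : {q : ℚ // 0 < q} := ⟨N, by exact_mod_cast hN0⟩
  have hqr : q = r ^ n := by
    apply Subtype.ext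
    rw [hq]
    exact (Positive.coe_zpow r n).symm
  rw [hqr]
  refine Subgroup.zpow_mem _ ?_ n
  rw [mem_stabilizer_mk_mk_iff]
  obtain ⟨σ, hσ, hy⟩ := exists_galHom_residueFieldEnd_eq_pow normal hx
  refine ⟨1, σ, hσ, fun z ↦ ?_⟩
  have h1 : (posNum r : ℕ) = N := by simp [posNum, r]
  have h2 : (posDen r : ℕ) = 1 := by simp [posDen, r]
  rw [h1, h2, PNat.one_coe, one_mul, mul_one, pow_one, ← map_pow]
  congr 1
  apply Units.ext
  rw [Units.val_pow_eq_pow_val]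
  exact (hy z).symm

lemma exists_zpow_of_mem_stabilizer
    (radicial : ∀ N : ℕ, 0 < N → ∀ a : K,
      (Polynomial.X ^ N - Polynomial.C a : Polynomial K).Splits) {P : DotX E} {ν : ℕ+}
    (hx : IsClosed ({normProj X₀ K P.point.1} : Set X₀))
    [Finite (X₀.residueField (normProj X₀ K P.point.1))] {q : {q : ℚ // 0 < q}}
    (h : q ∈ MulAction.stabilizer {q : ℚ // 0 < q}
      (FrobColim.mk (DotX₀.mk P) ν : CheckX₀ E)) :
    ∃ n : ℤ, (q : ℚ) = (Nat.card (X₀.residueField (normProj X₀ K P.point.1)) : ℚ) ^ n := by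
  obtain ⟨μ, σ, hσ, hχ⟩ := (mem_stabilizer_mk_mk_iff P ν q).mp h
  have hsplit {N : ℕ} (hN : 0 < N) (y : (normalizationIn X₀ K).residueField P.point.1) :=
    splits_X_pow_sub_C_residueField radicial hx hN y
  have htors := isOfFinOrder_of_isIntegral ((normProj X₀ K).residueFieldMap P.point.1).hom
    (isIntegral_residueFieldMap _ _)
  rw [← posNum_div_posDen q]
  refine pow_eq_zpow_card_of_character ((normProj X₀ K).residueFieldMap P.point.1).hom
    (fun y N hN ↦ ?_) (fun N hN ↦ by simpa using hsplit hN 1) P.point.2 ?_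
    (residueFieldEnd (galHom X₀ σ) hσ)
    (residueFieldEnd_comp_residueFieldMap _ _ (galHom_normProj X₀ σ) hσ) μ.pos
    (posNum q).ne_zero (posDen q).ne_zero ?_ hχ
  · obtain ⟨z, hz⟩ := (hsplit hN y).exists_eval_eq_zero (by
      rw [Polynomial.degree_X_pow_sub_C hN]
      exact_mod_cast hN.ne')
    exact ⟨z, by simpa [sub_eq_zero] using hz⟩
  -- Since all of `κ(x)ˣ` is torsion, finiteness of the torsion of `ker χ` is finiteness of `ker χ`.
  · refine (E.maxCondition _ _ P.holds).1.subset fun y hy ↦ ⟨hy, htors y⟩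
  · have := q.1.reduced
    rwa [show q.1.num.natAbs = posNum q by
      have := Rat.num_pos.2 q.2
      simp only [posNum, PNat.mk_coe]
      omega] at this

end Main

end ArithScheme

end

open ArithScheme in
/-- `X₀` is an integral normal scheme, flat and of finite type over `ℤ`; `K` is a radicially closed
Galois extension of its function field; `C` is an algebraically closed field of characteristic
zero. -/
theorem theorem2
    (X₀ : Scheme.{u}) [IsIntegral X₀]
    (normal : ∀ x : X₀, IsIntegrallyClosed (X₀.presheaf.stalk x))
    (s : X₀ ⟶ Spec (CommRingCat.of (ULift.{u} ℤ))) [Flat s] [LocallyOfFiniteType s]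
    [QuasiCompact s]
    (K : Type u) [Field K] [Algebra X₀.functionField K] [IsGalois X₀.functionField K]
    (radicial : ∀ N : ℕ, 0 < N → ∀ a : K,
      (Polynomial.X ^ N - Polynomial.C a : Polynomial K).Splits)
    (C : Type v) [Field C] [IsAlgClosed C] [CharZero C]
    (E : CharCondition X₀ K C) :
    {P : CheckX₀ E | MulAction.stabilizer {q : ℚ // 0 < q} P ≠ ⊥} =
        ⋃ x₀ ∈ {x₀ : X₀ | IsClosed ({x₀} : Set X₀)}, fiberC E x₀ ∧
      {x₀ : X₀ | IsClosed ({x₀} : Set X₀)}.PairwiseDisjoint (fiberC E) ∧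
      ∀ x₀ : X₀, IsClosed ({x₀} : Set X₀) →
        Finite (X₀.residueField x₀) ∧
          ∀ P ∈ fiberC E x₀, ∀ q : {q : ℚ // 0 < q},
            q ∈ MulAction.stabilizer {q : ℚ // 0 < q} P ↔
              ∃ n : ℤ, (q : ℚ) = (Nat.card (X₀.residueField x₀) : ℚ) ^ n := by
  have hstab : ∀ x₀ : X₀, IsClosed ({x₀} : Set X₀) →
      Finite (X₀.residueField x₀) ∧
        ∀ P ∈ fiberC E x₀, ∀ q : {q : ℚ // 0 < q},
          q ∈ MulAction.stabilizer {q : ℚ // 0 < q} P ↔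
            ∃ n : ℤ, (q : ℚ) = (Nat.card (X₀.residueField x₀) : ℚ) ^ n := by
    intro x₀ hx₀
    have hfin := finite_residueField_of_isClosed s hx₀
    refine ⟨hfin, fun P hP q ↦ ?_⟩
    obtain ⟨p, ν, rfl⟩ := CheckX₀.exists_rep P
    obtain rfl : normProj X₀ K p.point.1 = x₀ := hP
    exact ⟨exists_zpow_of_mem_stabilizer radicial hx₀,
      fun ⟨n, hn⟩ ↦ card_zpow_mem_stabilizer normal ν hx₀ hn⟩
  refine ⟨?_, ?_, hstab⟩
  · ext P
    simp only [Set.mem_ofPred_eq, Set.mem_iUnion, exists_prop]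
    constructor
    · intro hP
      obtain ⟨q, hq, hq1⟩ := (Subgroup.bot_or_exists_ne_one _).resolve_left hP
      obtain ⟨p, ν, rfl⟩ := CheckX₀.exists_rep P
      exact ⟨normProj X₀ K p.point.1, isClosed_of_mem_stabilizer hq1 hq, rfl⟩
    · rintro ⟨x₀, hx₀, hP⟩ hbot
      obtain ⟨hfin, h⟩ := hstab x₀ hx₀
      -- A field has at least two elements, so `Nx₀` is a nontrivial element of the stabilizer.
      have hN : 1 < Nat.card (X₀.residueField x₀) := Finite.one_lt_card
      have hmem := (h P hP ⟨Nat.card (X₀.residueField x₀), by positivity⟩).mpr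
        ⟨1, (zpow_one _).symm⟩
      rw [hbot, Subgroup.mem_bot, Subtype.ext_iff] at hmem
      have h1 : ((Nat.card (X₀.residueField x₀) : ℕ) : ℚ) = 1 := hmem
      exact hN.ne' (by exact_mod_cast h1)
  · intro x₀ _ y₀ _ hne
    rw [Function.onFun, Set.disjoint_left]
    intro P hP hP'
    exact hne (Eq.trans (Eq.symm hP) hP')
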